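/- \textbf{Setting.} Let $(\Omega,\mathcal F_T,P)$ be a probability space, $d\in\mathbb N$, $1\le p\le\infty$, $\frac1p+\frac1q=1$, and $L^p_d=L^p(\Omega,\mathcal F_T,P;\mathbb R^d)$. Let $M\subseteq\mathbb R^d$ be a linear subspace with $M\cap\mathbb R^d_+\neq\{0\}$, and let $K_I\subseteq\mathbb R^d$ be a closed convex cone with $\mathbb R^d_+\subseteq K_I\neq\mathbb R^d$. Put $K_I^M=K_I\cap M$ and let $K_I^+=\{v: v^Tx\ge 0\ \forall x\in K_I\}$ be the dual cone. Assume that $K_I^++M^\perp$ is closed; equivalently, $K_I^++M^\perp$ is the dual cone of $K_I^M$ in $\mathbb R^d$ (this holds, e.g., if $K_I$ is polyhedral or $M=\mathbb R^d$). For every $\omega\in\Omega$ let $K_T(\omega)\subseteq\mathbb R^d$ be a closed convex cone with $\mathbb R^d_+\subseteq K_T(\omega)\ne\mathbb R^d$ such that $\{\omega: K_T(\omega)\cap B\neq\emptyset\}\in\mathcal F_T$ for all open $B\subseteq\mathbb R^d$. Let $L^p_d(K_T)=\{X\in L^p_d: X\in K_T \text{ a.s.}\}$, $(L^p_d)_+=\{X\in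 L^p_d: X\in\mathbb R^d_+ \text{ a.s.}\}$, $L^q_d(K_T^+)=\{Y\in L^q_d: Y(\omega)\in K_T(\omega)^+ \text{ a.s.}\}$, $G(w)=\{x\in\mathbb R^d: 0\le w^Tx\}$ and $$\mathbb G_M=\{D\subseteq\mathbb R^d: D=\operatorname{cl}\operatorname{co}(D+K_I^M)\}.$$ A map $R$ from $L^p_d$ into the subsets of $M$ is a \emph{risk measure} if $R(X+u\mathbf 1)=R(X)-u$ for all $X\in L^p_d$, $u\in M$, and $X^2-X^1\in (L^p_d)_+$ implies $R(X^2)\supseteq R(X^1)$. It is \emph{finite at zero} if $R(0)\notin\{\emptyset,M\}$; \emph{market-compatible} if $X^2-X^1\in L^p_d(K_T)$ implies $R(X^2)\supseteq R(X^1)$ and $R(X)=R(X)+K_I^M$ for all $X$; \emph{closed} if its graph $\{(X,u): u\in R(X)\}$ is closed, where $L^p_d$ carries the norm topology if $p<\infty$ and $\sigma(L^\infty_d,L^1_d)$ if $p=\infty$; \emph{convex} if $R(tX+(1-t)X')\supseteq tR(X)+(1-t)R(X')$ for $t\in(0,1)$; \emph{coherent} if $R(tX)\supseteq tR(X)$ for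 $t>0$ and $R(X+X')\supseteq R(X)+R(X')$. Let $A_R=\{X\in L^p_d: 0\in R(X)\}$ and $A_R^+=\{Y\in L^q_d: E[X^TY]\ge0\ \forall X\in A_R\}$. Let $\mathcal M^P_{1,d}$ be the set of vectors $Q=(Q_1,\dots,Q_d)$ of probability measures on $(\Omega,\mathcal F_T)$ with $Q_i\ll P$, and $E^Q[X]=(E^{Q_1}[X_1],\dots,E^{Q_d}[X_d])^T$. Let $$\mathcal W^q=\Big\{(Q,w)\in\mathcal M^P_{1,d}\times\mathbb R^d: w\in K_I^+\setminus M^\perp+M^\perp,\ \operatorname{diag}(w)\tfrac{dQ}{dP}\in L^q_d(K_T^+)\Big\}.$$ (Components of $E^Q[X]$ with $w_i=0$, which need not exist, do not influence $E^Q[X]+G(w)=\{x: w^Tx\ge \sum_{w_i\neq0}w_iE^{Q_i}[X_i]\}$.) A \emph{penalty function} is a map $-\alpha:\mathcal W^q\to\mathbb G_M$ with $\bigcap_{(Q,w)\in\mathcal W^q}-\alpha(Q,w)\ne\emptyset$, $-\alpha(Q,w)\ne M$ for at least one $(Q,w)\in\mathcal W^q$, and $-\alpha(Q,w)=\operatorname{cl}(-\alpha(Q,w)+G(w))\cap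 M$ for all $(Q,w)\in\mathcal W^q$. \textbf{Theorem.} Let $R$ be a map from $L^p_d$ into the subsets of $\mathbb R^d$. (a) $R$ takes values in $\mathbb G_M$ and is a market-compatible closed convex risk measure which is finite at zero if and only if there is a penalty function $-\alpha_R$ such that $$\forall X\in L^p_d:\quad R(X)=\bigcap_{(Q,w)\in\mathcal W^q}\big[-\alpha_R(Q,w)+(E^Q[-X]+G(w))\cap M\big].\qquad(1)$$ In this case $$-\alpha_{R,\min}(Q,w)=\operatorname{cl}\bigcup_{X'\in A_R}(E^Q[X']+G(w))\cap M$$ is a penalty function which satisfies (1). Moreover, if a penalty function $-\alpha_R$ satisfies (1), then $-\alpha_R(Q,w)\supseteq-\alpha_{R,\min}(Q,w)$ for all $(Q,w)\in\mathcal W^q$. (b) $R$ takes values in $\mathbb G_M$ and is a market-compatible closed coherent risk measure which is finite at zero if and only if there is a nonempty set $\mathcal W^q_R\subseteq\mathcal W^q$ such that $$\forall X\in L^p_d:\quad R(X)=\bigcap_{(Q,w)\in\mathcal W^q_R}(E^Q[-X]+G(w))\cap M.\qquad(2)$$ In this case $$\mathcal W^q_{R,\max}=\Big\{(Q,w)\in\mathcal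 M^P_{1,d}\times\mathbb R^d: w\in K_I^+\setminus M^\perp+M^\perp,\ \operatorname{diag}(w)\tfrac{dQ}{dP}\in A_R^+\Big\}$$ is a nonempty subset of $\mathcal W^q$, and (2) is satisfied with $\mathcal W^q_R$ replaced by $\mathcal W^q_{R,\max}$. Moreover, if $\mathcal W^q_R\subseteq\mathcal W^q$ satisfies (2), then $\mathcal W^q_R\subseteq\mathcal W^q_{R,\max}$. -/

import Mathlib

open MeasureTheory Set
open scoped ENNReal Pointwise

namespace SetRisk

/-- `ℝ^d`. -/
abbrev Vec (d : ℕ) : Type := EuclideanSpace ℝ (Fin d)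

/-- The nonnegative orthant `ℝ^d_+`. -/
def orthant (d : ℕ) : Set (Vec d) := {x | ∀ i, 0 ≤ x i}

/-- The half-space `G(v) = {x | 0 ≤ vᵀ x}` of `ℝ^d`. -/
def halfSpace {d : ℕ} (v : Vec d) : Set (Vec d) := {x | 0 ≤ inner ℝ v x}

/-- The cone `K_I^M = K_I ∩ M`. -/
def eligibleCone {d : ℕ} (KI : ProperCone ℝ (Vec d)) (M : Submodule ℝ (Vec d)) : Set (Vec d) :=
  (KI : Set (Vec d)) ∩ (M : Set (Vec d))

/-- The family `𝔾_M` of all sets `D ⊆ ℝ^d` with `D = cl co (D + K_I^M)`. -/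
def GM {d : ℕ} (KI : ProperCone ℝ (Vec d)) (M : Submodule ℝ (Vec d)) : Set (Set (Vec d)) :=
  {D | D = closure (convexHull ℝ (D + eligibleCone KI M))}

/-- Measurability of a set-valued map: preimages of open sets (in the hitting sense) are
measurable. -/
def IsMeasurableSetValued {Ω : Type*} [MeasurableSpace Ω] {d : ℕ} (K : Ω → Set (Vec d)) : Prop :=
  ∀ B : Set (Vec d), IsOpen B → MeasurableSet {ω | (K ω ∩ B).Nonempty}

section RiskMeasures

variable {Ω : Type*} [MeasurableSpace Ω] {P : Measure Ω} {d : ℕ} {p : ℝ≥0∞}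

/-- The cone `L^p_d(K)` of all `X ∈ L^p_d` with `X ∈ K` almost surely. -/
def LpIn (p : ℝ≥0∞) (P : Measure Ω) (K : Ω → Set (Vec d)) : Set (Lp (Vec d) p P) :=
  {X | ∀ᵐ ω ∂P, X ω ∈ K ω}

/-- `M`-translativity: `R(X + u𝟙) = R(X) - u` for all `u ∈ M`. -/
def IsTranslative [IsFiniteMeasure P] (M : Submodule ℝ (Vec d))
    (R : Lp (Vec d) p P → Set (Vec d)) : Prop :=
  ∀ X, ∀ u ∈ M, R (X + Lp.const p P u) = R X - {u}

/-- `B`-monotonicity: `X₂ - X₁ ∈ B` implies `R(X₂) ⊇ R(X₁)`. -/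
def IsMonotoneWrt (B : Set (Lp (Vec d) p P)) (R : Lp (Vec d) p P → Set (Vec d)) : Prop :=
  ∀ X₁ X₂, X₂ - X₁ ∈ B → R X₁ ⊆ R X₂

/-- A risk measure: a map from `L^p_d` into the subsets of `M` that is `M`-translative and
`(L^p_d)_+`-monotone. -/
structure IsRiskMeasure [IsFiniteMeasure P] (M : Submodule ℝ (Vec d))
    (R : Lp (Vec d) p P → Set (Vec d)) : Prop where
  subset_M : ∀ X, R X ⊆ (M : Set (Vec d))
  translative : IsTranslative M R
  monotone : IsMonotoneWrt (LpIn p P fun _ => orthant d) R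

/-- Finiteness at zero: `R(0) ≠ ∅` and `R(0) ≠ M`. -/
def IsFiniteAtZero (M : Submodule ℝ (Vec d)) (R : Lp (Vec d) p P → Set (Vec d)) : Prop :=
  R 0 ≠ ∅ ∧ R 0 ≠ (M : Set (Vec d))

/-- Market-compatibility: `L^p_d(K_T)`-monotonicity (`K_T`-compatibility) and
`R(X) = R(X) + K_I^M` for all `X` (`K_I`-compatibility). -/
def IsMarketCompatible (M : Submodule ℝ (Vec d)) (KI : ProperCone ℝ (Vec d))
    (KT : Ω → ProperCone ℝ (Vec d)) (R : Lp (Vec d) p P → Set (Vec d)) : Prop :=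
  IsMonotoneWrt (LpIn p P fun ω => (KT ω : Set (Vec d))) R ∧
    ∀ X, R X = R X + eligibleCone KI M

/-- Convexity of a set-valued map. -/
def IsConvexMap (R : Lp (Vec d) p P → Set (Vec d)) : Prop :=
  ∀ X X' : Lp (Vec d) p P, ∀ t : ℝ, 0 < t → t < 1 →
    t • R X + (1 - t) • R X' ⊆ R (t • X + (1 - t) • X')

/-- Positive homogeneity of a set-valued map. -/
def IsPosHomogeneous (R : Lp (Vec d) p P → Set (Vec d)) : Prop :=
  ∀ X : Lp (Vec d) p P, ∀ t : ℝ, 0 < t → t • R X ⊆ R (t • X)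

/-- Subadditivity of a set-valued map. -/
def IsSubadditive (R : Lp (Vec d) p P → Set (Vec d)) : Prop :=
  ∀ X X' : Lp (Vec d) p P, R X + R X' ⊆ R (X + X')

/-- The graph of `R`. -/
def graph (R : Lp (Vec d) p P → Set (Vec d)) : Set (Lp (Vec d) p P × Vec d) :=
  {z | z.2 ∈ R z.1}

/-- The topology `σ(L^p_d, L^q_d)`: the coarsest one for which `X ↦ E[Xᵀ Y]` is continuous for
every `Y ∈ L^q_d`. -/
@[reducible] noncomputable def pairingTopology (P : Measure Ω) (d : ℕ) (p q : ℝ≥0∞) :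
    TopologicalSpace (Lp (Vec d) p P) :=
  TopologicalSpace.induced
    (fun (X : Lp (Vec d) p P) (Y : Lp (Vec d) q P) => ∫ ω, inner ℝ (X ω) (Y ω) ∂P)
    Pi.topologicalSpace

/-- Closedness of `R`: its graph is closed, for the norm topology on `L^p_d` if `p < ∞` and for
the topology `σ(L^∞_d, L^1_d)` if `p = ∞`. -/
def IsClosedMap [Fact (1 ≤ p)] (R : Lp (Vec d) p P → Set (Vec d)) : Prop :=
  (p ≠ ∞ → IsClosed (graph R)) ∧
    (p = ∞ → @IsClosed (Lp (Vec d) p P × Vec d)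
      (@instTopologicalSpaceProd _ _ (pairingTopology P d p 1) inferInstance) (graph R))

/-- The acceptance set `A_R = {X | 0 ∈ R(X)}`. -/
def acceptanceSet (R : Lp (Vec d) p P → Set (Vec d)) : Set (Lp (Vec d) p P) :=
  {X | (0 : Vec d) ∈ R X}

/-- `R` is a `𝔾_M`-valued market-compatible closed convex risk measure, finite at zero. -/
structure IsClosedConvexRiskMeasure [IsFiniteMeasure P] [Fact (1 ≤ p)]
    (M : Submodule ℝ (Vec d)) (KI : ProperCone ℝ (Vec d)) (KT : Ω → ProperCone ℝ (Vec d))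
    (R : Lp (Vec d) p P → Set (Vec d)) : Prop where
  mem_GM : ∀ X, R X ∈ GM KI M
  riskMeasure : IsRiskMeasure M R
  marketCompatible : IsMarketCompatible M KI KT R
  closed : IsClosedMap R
  convex : IsConvexMap R
  finiteAtZero : IsFiniteAtZero M R

/-- `R` is a `𝔾_M`-valued market-compatible closed coherent (that is, positively homogeneous and
subadditive) risk measure, finite at zero. -/
structure IsClosedCoherentRiskMeasure [IsFiniteMeasure P] [Fact (1 ≤ p)]
    (M : Submodule ℝ (Vec d)) (KI : ProperCone ℝ (Vec d)) (KT : Ω → ProperCone ℝ (Vec d))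
    (R : Lp (Vec d) p P → Set (Vec d)) : Prop where
  mem_GM : ∀ X, R X ∈ GM KI M
  riskMeasure : IsRiskMeasure M R
  marketCompatible : IsMarketCompatible M KI KT R
  closed : IsClosedMap R
  posHomogeneous : IsPosHomogeneous R
  subadditive : IsSubadditive R
  finiteAtZero : IsFiniteAtZero M R

end RiskMeasures

section Dual

variable {Ω : Type*} [MeasurableSpace Ω] {d : ℕ} {p : ℝ≥0∞}

/-- The set `𝓜^P_{1,d}` of vectors of `d` probability measures that are absolutely continuous
with respect to `P`. -/
def vecProb (P : Measure Ω) (d : ℕ) : Set (Fin d → Measure Ω) :=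
  {Q | ∀ i, IsProbabilityMeasure (Q i) ∧ Q i ≪ P}

/-- The random vector `diag(w) dQ/dP`. -/
noncomputable def density (P : Measure Ω) (Q : Fin d → Measure Ω) (w : Vec d) (ω : Ω) : Vec d :=
  WithLp.toLp 2 fun i => w i * ((Q i).rnDeriv P ω).toReal

/-- The vector `E^Q[X] = (E^{Q₁}[X₁], …, E^{Q_d}[X_d])`. For `(Q, w)` in the set `Wq` below, `X i`
is integrable under `Q i` whenever `w i ≠ 0`; the components with `w i = 0` have no influence on
the set `E^Q[X] + G(w)`. -/
noncomputable def expect {P : Measure Ω} (Q : Fin d → Measure Ω) (X : Lp (Vec d) p P) : Vec d :=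
  WithLp.toLp 2 fun i => ∫ ω, X ω i ∂(Q i)

/-- The set `(E^Q[X] + G(w)) ∩ M`. -/
noncomputable def expectSet {P : Measure Ω} (M : Submodule ℝ (Vec d))
    (z : (Fin d → Measure Ω) × Vec d) (X : Lp (Vec d) p P) : Set (Vec d) :=
  ({expect z.1 X} + halfSpace z.2) ∩ (M : Set (Vec d))

/-- The set `K_I^+ \ M^⊥ + M^⊥`. -/
def weightSet (M : Submodule ℝ (Vec d)) (KI : ProperCone ℝ (Vec d)) : Set (Vec d) :=
  ((ProperCone.innerDual (KI : Set (Vec d)) : Set (Vec d)) \ (Mᗮ : Set (Vec d)))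
    + (Mᗮ : Set (Vec d))

/-- The set `𝓦^q` of dual variables. -/
def Wq (P : Measure Ω) (q : ℝ≥0∞) (M : Submodule ℝ (Vec d)) (KI : ProperCone ℝ (Vec d))
    (KT : Ω → ProperCone ℝ (Vec d)) : Set ((Fin d → Measure Ω) × Vec d) :=
  {z | z.1 ∈ vecProb P d ∧ z.2 ∈ weightSet M KI ∧ MemLp (density P z.1 z.2) q P ∧
    ∀ᵐ ω ∂P, density P z.1 z.2 ω ∈ ProperCone.innerDual (KT ω : Set (Vec d))}

/-- The dual cone `A^+` in `L^q_d` of a set `A` in `L^p_d`: all `Y ∈ L^q_d` with `E[Xᵀ Y] ≥ 0` for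
all `X ∈ A`. -/
def dualConeLq {P : Measure Ω} (q : ℝ≥0∞) (A : Set (Lp (Vec d) p P)) : Set (Ω → Vec d) :=
  {Y | MemLp Y q P ∧ ∀ X ∈ A, 0 ≤ ∫ ω, inner ℝ (X ω) (Y ω) ∂P}

/-- The set `𝓦^q_{R,max}`. -/
def WqMax {P : Measure Ω} (q : ℝ≥0∞) (M : Submodule ℝ (Vec d)) (KI : ProperCone ℝ (Vec d))
    (R : Lp (Vec d) p P → Set (Vec d)) : Set ((Fin d → Measure Ω) × Vec d) :=
  {z | z.1 ∈ vecProb P d ∧ z.2 ∈ weightSet M KI ∧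
    density P z.1 z.2 ∈ dualConeLq q (acceptanceSet R)}

/-- Penalty functions `-α : 𝓦^q → 𝔾_M`. The minus sign belongs to the name of the set-valued
function, which is called `negα` here. -/
structure IsPenalty {P : Measure Ω} {q : ℝ≥0∞} (M : Submodule ℝ (Vec d))
    (KI : ProperCone ℝ (Vec d)) (KT : Ω → ProperCone ℝ (Vec d))
    (negα : Wq P q M KI KT → Set (Vec d)) : Prop where
  mem_GM : ∀ z, negα z ∈ GM KI M
  inter_nonempty : (⋂ z, negα z).Nonempty
  ne_M : ∃ z, negα z ≠ (M : Set (Vec d))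
  add_halfSpace : ∀ z, negα z = closure (negα z + halfSpace z.1.2) ∩ (M : Set (Vec d))

/-- The representation `R(X) = ⋂_{(Q,w) ∈ 𝓦^q} [-α(Q,w) + (E^Q[-X] + G(w)) ∩ M]` for all `X`. -/
def Represents {P : Measure Ω} {q : ℝ≥0∞} (M : Submodule ℝ (Vec d))
    (KI : ProperCone ℝ (Vec d)) (KT : Ω → ProperCone ℝ (Vec d))
    (negα : Wq P q M KI KT → Set (Vec d)) (R : Lp (Vec d) p P → Set (Vec d)) : Prop :=
  ∀ X, R X = ⋂ z, (negα z + expectSet M z.1 (-X))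

/-- The representation `R(X) = ⋂_{(Q,w) ∈ W} (E^Q[-X] + G(w)) ∩ M` for all `X`. -/
def CoherentlyRepresents {P : Measure Ω} (M : Submodule ℝ (Vec d))
    (W : Set ((Fin d → Measure Ω) × Vec d)) (R : Lp (Vec d) p P → Set (Vec d)) : Prop :=
  ∀ X, R X = ⋂ z ∈ W, expectSet M z (-X)

/-- The minimal penalty `-α_{R,min}(Q,w) = cl ⋃_{X' ∈ A_R} (E^Q[X'] + G(w)) ∩ M`. -/
noncomputable def minPenalty {P : Measure Ω} {q : ℝ≥0∞} (M : Submodule ℝ (Vec d))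
    (KI : ProperCone ℝ (Vec d)) (KT : Ω → ProperCone ℝ (Vec d))
    (R : Lp (Vec d) p P → Set (Vec d)) (z : Wq P q M KI KT) : Set (Vec d) :=
  closure (⋃ X' ∈ acceptanceSet R, expectSet M z.1 X')

end Dual

end SetRisk

/-! By translativity, `u ∈ R X` holds exactly when `u ∈ M` and `X + u𝟙` is acceptable, so `R` is
recovered from its acceptance set `A`, a closed convex set stable under adding `L^p_d(K_T)` and the
constants in `K_I^M`. Hahn–Banach separates an unacceptable `X` from `A` by some `Y ∈ L^q_d`
(`exists_pairing_separation`). A functional bounded below on `A` is nonnegative on every direction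
of recession of `A`. Hence `Y ∈ K_T^+` a.s., and `w = E[Y]` lies in the dual cone of `K_I^M`, which
is `K_I^+ + M^⊥` because that sum is closed. Normalising the components of `Y` gives `Y = diag(w)
dQ/dP`. The one obstacle is `w ∈ M^⊥`; finiteness at zero supplies a second functional that is
nonconstant on `M`, and adding a small multiple of it repairs the separation (`exists_separation`).

On the dual side, `wᵀ E^Q[X] = E[Xᵀ Y]` makes `(E^Q[-X] + G(w)) ∩ M` a half-space of `M`. For `w ∉
M^⊥` every value of a penalty function is `M` or such a half-space, and Minkowski sums add
thresholds. Both representations thus become systems of scalar inequalities `c ≤ wᵀu + E[Xᵀ Y]`,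
from which all properties of `R` are read off (`isClosedConvexRiskMeasure_of_mem_iff`). In the
coherent case `A` is closed under addition and contains `0`, so the thresholds can be taken to be
`0`. -/

namespace SetRisk

/-! ### Riesz representation of positive functionals on `L^p_d` for `p < ∞`. -/

section Duality

open Filter Topology Function
open scoped NNReal symmDiff

variable {Ω : Type*} [MeasurableSpace Ω] {P : Measure Ω} {p q : ℝ≥0∞}

/-- A Radon–Nikodym derivative is in `L^q` if its integrals against simple functions are bounded
by a multiple of their `L^p` norms. -/
theorem memLp_rnDeriv_of_lintegral_le [IsFiniteMeasure P] {ν : Measure Ω} [IsFiniteMeasure ν]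
    [hpq : p.HolderConjugate q] (hν : ν ≪ P) (hp : p ≠ ∞) (C : ℝ≥0)
    (hC : ∀ s : SimpleFunc Ω ℝ≥0, ∫⁻ ω, s ω ∂ν ≤ C * eLpNorm (fun ω => (s ω : ℝ)) p P) :
    MemLp (fun ω => (ν.rnDeriv P ω).toReal) q P := by
  have hmeas : Measurable (ν.rnDeriv P) := Measure.measurable_rnDeriv ν P
  have haesm : AEStronglyMeasurable (fun ω => (ν.rnDeriv P ω).toReal) P :=
    hmeas.ennreal_toReal.aestronglyMeasurable
  by_cases hq : q = ∞
  · subst hq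
    have hp1 : p = 1 := by simpa using hpq.inv_add_inv_eq_inv
    subst hp1
    have hle : ν.rnDeriv P ≤ᵐ[P] fun _ => (C : ℝ≥0∞) := by
      refine ae_le_of_forall_setLIntegral_le_of_sigmaFinite hmeas fun A hA _ => ?_
      rw [Measure.setLIntegral_rnDeriv hν, setLIntegral_const]
      have h := hC (SimpleFunc.piecewise A hA (SimpleFunc.const Ω 1) (SimpleFunc.const Ω 0))
      have e1 : (fun ω => (((SimpleFunc.piecewise A hA (SimpleFunc.const Ω 1)
          (SimpleFunc.const Ω 0)) ω : ℝ≥0) : ℝ≥0∞)) = A.indicator 1 := by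
        ext ω; by_cases hω : ω ∈ A <;> simp [hω]
      have e2 : (fun ω => (((SimpleFunc.piecewise A hA (SimpleFunc.const Ω 1)
          (SimpleFunc.const Ω 0)) ω : ℝ≥0) : ℝ)) = A.indicator fun _ => (1 : ℝ) := by
        ext ω; by_cases hω : ω ∈ A <;> simp [hω]
      rw [e1, e2, lintegral_indicator_one hA, eLpNorm_indicator_const hA one_ne_zero
        ENNReal.one_ne_top] at h
      simpa using h
    refine memLp_top_of_bound haesm C ?_
    filter_upwards [hle] with ω hω
    rw [Real.norm_of_nonneg ENNReal.toReal_nonneg]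
    exact ENNReal.toReal_le_coe_of_le_coe hω
  · have hpq' := ENNReal.HolderConjugate.toReal_of_ne_top hp hq
    set a := p.toReal
    set b := q.toReal
    have hp0 : p ≠ 0 := fun h => by simpa [a, h] using hpq'.pos
    have hq0 : q ≠ 0 := fun h => by simpa [b, h] using hpq'.symm.pos
    have hb : 0 < b := hpq'.symm.pos
    have ha : 0 < a := hpq'.pos
    have hb1 : 0 < b - 1 := hpq'.symm.sub_one_pos
    have hba : (b - 1) * a = b := by
      have := hpq'.symm.sub_one_mul_conj
      linarith
    let s : ℕ → SimpleFunc Ω ℝ≥0 := fun n =>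
      (SimpleFunc.eapprox (ν.rnDeriv P) n).map ENNReal.toNNReal
    have hs : ∀ n ω, (s n ω : ℝ≥0∞) = SimpleFunc.eapprox (ν.rnDeriv P) n ω := fun n ω => by
      simp only [s, SimpleFunc.map_apply]
      exact ENNReal.coe_toNNReal (SimpleFunc.eapprox_lt_top _ n ω).ne
    have hsle : ∀ n ω, (s n ω : ℝ≥0∞) ≤ ν.rnDeriv P ω := fun n ω => by
      rw [hs, ← SimpleFunc.iSup_eapprox_apply hmeas ω]
      exact le_iSup (fun n => SimpleFunc.eapprox (ν.rnDeriv P) n ω) n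
    -- Test the bound with `s ^ (b - 1)`: since `(b - 1) * a = b`, this gives `I ≤ C * I ^ (1 / a)`.
    -- Dividing is legitimate because `s` is bounded and `P` finite, so `I < ∞`.
    have key : ∀ n, ∫⁻ ω, (s n ω : ℝ≥0∞) ^ b ∂P ≤ (C : ℝ≥0∞) ^ b := fun n => by
      set I := ∫⁻ ω, (s n ω : ℝ≥0∞) ^ b ∂P with hI
      have hItop : I ≠ ∞ := by
        obtain ⟨B, hB⟩ := (s n).exists_forall_le
        refine ((lintegral_mono (g := fun _ => (B : ℝ≥0∞) ^ b) fun ω => ?_).trans_lt ?_).ne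
        · exact ENNReal.rpow_le_rpow (ENNReal.coe_le_coe.2 (hB ω)) hb.le
        · rw [lintegral_const]
          exact ENNReal.mul_lt_top (ENNReal.rpow_lt_top_of_nonneg hb.le ENNReal.coe_ne_top)
            (measure_lt_top P _)
      have h1 : I ≤ C * I ^ (1 / a) := by
        calc I ≤ ∫⁻ ω, (ν.rnDeriv P ω) * ((s n).map fun x : ℝ≥0 => x ^ (b - 1)) ω ∂P := by
              refine lintegral_mono fun ω => ?_
              simp only [SimpleFunc.map_apply]
              calc (s n ω : ℝ≥0∞) ^ b = (s n ω : ℝ≥0∞) * (s n ω : ℝ≥0∞) ^ (b - 1) := by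
                    conv_lhs => rw [show b = 1 + (b - 1) by ring]
                    rw [ENNReal.rpow_add_of_nonneg _ _ zero_le_one hb1.le, ENNReal.rpow_one]
                _ ≤ _ := by
                    rw [← ENNReal.coe_rpow_of_nonneg _ hb1.le]
                    gcongr
                    exact hsle n ω
          _ = ∫⁻ ω, ((s n).map fun x : ℝ≥0 => x ^ (b - 1)) ω ∂ν := by
              exact lintegral_rnDeriv_mul hν (by fun_prop)
          _ ≤ _ := hC _
          _ = C * I ^ (1 / a) := by
              rw [eLpNorm_eq_lintegral_rpow_enorm_toReal hp0 hp]
              congr 3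
              ext ω
              simp only [SimpleFunc.map_apply]
              rw [Real.enorm_of_nonneg (NNReal.coe_nonneg _), ENNReal.ofReal_coe_nnreal,
                ENNReal.coe_rpow_of_nonneg _ hb1.le, ← ENNReal.rpow_mul, hba]
      by_cases hI0 : I = 0
      · simp [hI0]
      · have h2 : I ^ (1 / b) ≤ C := by
          have e : I = I ^ (1 / b) * I ^ (1 / a) := by
            rw [← ENNReal.rpow_add _ _ hI0 hItop]
            have := hpq'.symm.inv_add_inv_eq_one
            rw [one_div, one_div, this, ENNReal.rpow_one]
          have hne : I ^ (1 / a) ≠ 0 := by simp [hI0, hItop]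
          have hnt : I ^ (1 / a) ≠ ∞ := ENNReal.rpow_ne_top_of_nonneg (by positivity) hItop
          conv_lhs at h1 => rw [e]
          exact (ENNReal.mul_le_mul_iff_left hne hnt).1 h1
        calc I = (I ^ (1 / b)) ^ b := by
              rw [← ENNReal.rpow_mul, one_div_mul_cancel hb.ne', ENNReal.rpow_one]
          _ ≤ _ := by gcongr
    refine ⟨haesm, ?_⟩
    rw [eLpNorm_lt_top_iff_lintegral_rpow_enorm_lt_top hq0 hq]
    calc ∫⁻ ω, ‖(ν.rnDeriv P ω).toReal‖ₑ ^ b ∂P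
        ≤ ∫⁻ ω, (ν.rnDeriv P ω) ^ b ∂P := by
          refine lintegral_mono fun ω => ?_
          gcongr
          rw [Real.enorm_of_nonneg ENNReal.toReal_nonneg]
          exact ENNReal.ofReal_toReal_le
      _ = ∫⁻ ω, ⨆ n, (s n ω : ℝ≥0∞) ^ b ∂P := by
          refine lintegral_congr fun ω => ?_
          rw [← SimpleFunc.iSup_eapprox_apply hmeas ω]
          simp_rw [hs]
          exact (ENNReal.orderIsoRpow b hb).map_iSup _
      _ = ⨆ n, ∫⁻ ω, (s n ω : ℝ≥0∞) ^ b ∂P := by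
          refine lintegral_iSup (fun n => by fun_prop) fun m n hmn ω => ?_
          simp only [hs]
          gcongr
          exact SimpleFunc.monotone_eapprox _ hmn ω
      _ ≤ (C : ℝ≥0∞) ^ b := iSup_le key
      _ < ∞ := ENNReal.rpow_lt_top_of_nonneg hb.le ENNReal.coe_ne_top

theorem indicatorConstLp_const_smul {E : Type*} [NormedAddCommGroup E] [NormedSpace ℝ E]
    {A : Set Ω} (hA : MeasurableSet A) (hPA : P A ≠ ∞) (a : ℝ) (e : E) :
    indicatorConstLp p hA hPA (a • e) = a • indicatorConstLp p hA hPA e := by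
  refine Lp.ext ?_
  filter_upwards [Lp.coeFn_smul a (indicatorConstLp p hA hPA e),
    indicatorConstLp_coeFn (p := p) (hs := hA) (hμs := hPA) (c := e),
    indicatorConstLp_coeFn (p := p) (hs := hA) (hμs := hPA) (c := a • e)] with ω h1 h2 h3
  rw [h1, h3, Pi.smul_apply, h2]
  by_cases hω : ω ∈ A <;> simp [hω]

/-- A functional on `L^p` that is nonnegative on the indicators in one direction is given on them
by integration against a function in `L^q`. -/
theorem exists_density_of_indicator_nonneg [IsFiniteMeasure P] [hpq : p.HolderConjugate q]
    [Fact (1 ≤ p)] (hp : p ≠ ∞) {E : Type*} [NormedAddCommGroup E] [NormedSpace ℝ E]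
    (φ : Lp E p P →L[ℝ] ℝ) (e : E)
    (hφ : ∀ (A : Set Ω) (hA : MeasurableSet A),
      0 ≤ φ (indicatorConstLp p hA (measure_ne_top P A) e)) :
    ∃ g : Ω → ℝ, MemLp g q P ∧ ∀ (A : Set Ω) (hA : MeasurableSet A),
      φ (indicatorConstLp p hA (measure_ne_top P A) e) = ∫ ω in A, g ω ∂P := by
  have hp1 : 1 ≤ p := Fact.out
  have hp0 : p ≠ 0 := (zero_lt_one.trans_le hp1).ne'
  let m : ∀ A : Set Ω, MeasurableSet A → ℝ := fun A hA =>
    φ (indicatorConstLp p hA (measure_ne_top P A) e)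
  have munion : ∀ (A B : Set Ω) (hA : MeasurableSet A) (hB : MeasurableSet B),
      Disjoint A B → m (A ∪ B) (hA.union hB) = m A hA + m B hB := fun A B hA hB hAB => by
    simp only [m]
    rw [indicatorConstLp_disjoint_union hA hB (measure_ne_top P A) (measure_ne_top P B) hAB,
      map_add]
  have mzero : ∀ (A : Set Ω) (hA : MeasurableSet A), P A = 0 → m A hA = 0 := fun A hA h0 => by
    have : indicatorConstLp p hA (measure_ne_top P A) e = 0 := by
      rw [← norm_eq_zero, norm_indicatorConstLp hp0 hp, Measure.real, h0]
      have : 0 < p.toReal := ENNReal.toReal_pos hp0 hp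
      simp [Real.zero_rpow (inv_pos.2 this).ne']
    simp only [m, this, map_zero]
  have msum : ∀ (f : ℕ → Set Ω) (hf : ∀ i, MeasurableSet (f i)), Pairwise (Disjoint on f) →
      HasSum (fun i => m (f i) (hf i)) (m (⋃ i, f i) (MeasurableSet.iUnion hf)) :=
    fun f hf hdisj => by
    -- Countable additivity is continuity of `φ`: the indicators of the finite unions converge in
    -- `L^p` because `p < ∞` and the tails of a disjoint sequence have measure tending to `0`.
    rw [hasSum_iff_tendsto_nat_of_nonneg fun i => (hφ (f i) (hf i) : 0 ≤ m (f i) (hf i))]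
    have hU : ∀ n, MeasurableSet (⋃ i ∈ Finset.range n, f i) := fun n =>
      Finset.measurableSet_biUnion _ fun i _ => hf i
    have hfin : ∀ n, ∑ i ∈ Finset.range n, m (f i) (hf i) =
        m (⋃ i ∈ Finset.range n, f i) (hU n) := fun n => by
      induction n with
      | zero =>
        rw [Finset.sum_range_zero, mzero _ (hU 0) (by simp)]
      | succ n ih =>
        rw [Finset.sum_range_succ, ih, ← munion _ _ _ _ ?_]
        · have : ⋃ i ∈ Finset.range (n + 1), f i = (⋃ i ∈ Finset.range n, f i) ∪ f n := by
            simp [Finset.range_add_one, union_comm]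
          simp only [this]
        · simp only [Finset.mem_range, disjoint_iUnion_left]
          exact fun i hi => hdisj (ne_of_lt hi)
    refine Tendsto.congr (fun n => (hfin n).symm) ?_
    refine (φ.continuous.tendsto _).comp (tendsto_indicatorConstLp_set hp ?_)
    refine tendsto_of_tendsto_of_tendsto_of_le_of_le tendsto_const_nhds
      (tendsto_measure_biUnion_Ici_zero_of_pairwise_disjoint (μ := P)
        (fun i => (hf i).nullMeasurableSet) hdisj) (fun _ => zero_le) fun n => ?_
    refine measure_mono fun ω hω => ?_
    simp only [mem_symmDiff, mem_iUnion, Finset.mem_range] at hω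
    simp only [mem_iUnion]
    grind
  -- Nonnegativity on indicators makes `ENNReal.ofReal` lossless, so this is a genuine measure, and
  -- its Radon–Nikodym derivative is the required function.
  let ν : Measure Ω := Measure.ofMeasurable (fun A hA => ENNReal.ofReal (m A hA))
    (by rw [mzero _ _ measure_empty, ENNReal.ofReal_zero]) (fun f hf hdisj => by
      rw [← (msum f hf hdisj).tsum_eq,
        ENNReal.ofReal_tsum_of_nonneg (fun i => hφ _ _) (msum f hf hdisj).summable])
  have hνA : ∀ (A : Set Ω) (hA : MeasurableSet A), ν A = ENNReal.ofReal (m A hA) :=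
    fun A hA => Measure.ofMeasurable_apply A hA
  have hνfin : IsFiniteMeasure ν := ⟨by rw [hνA _ MeasurableSet.univ]; exact ENNReal.ofReal_lt_top⟩
  have hνP : ν ≪ P := Measure.AbsolutelyContinuous.mk fun A hA h0 => by
    rw [hνA _ hA, mzero _ hA h0, ENNReal.ofReal_zero]
  -- The identity `∫ s dν = φ(s e)` for simple `s` turns boundedness of `φ` into the estimate that
  -- places the density in `L^q`.
  have hsimple : ∀ s : SimpleFunc Ω ℝ≥0, ∃ X : Lp E p P, X =ᵐ[P] (fun ω => (s ω : ℝ) • e) ∧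
      0 ≤ φ X ∧ ∫⁻ ω, s ω ∂ν = ENNReal.ofReal (φ X) := fun s => by
    induction s using SimpleFunc.induction with
    | const c hA =>
      rename_i A
      refine ⟨(c : ℝ) • indicatorConstLp p hA (measure_ne_top P A) e, ?_, ?_, ?_⟩
      · filter_upwards [Lp.coeFn_smul (c : ℝ) (indicatorConstLp p hA (measure_ne_top P A) e),
          indicatorConstLp_coeFn (p := p) (hs := hA) (hμs := measure_ne_top P A) (c := e)]
          with ω h1 h2
        rw [h1, Pi.smul_apply, h2]
        by_cases hω : ω ∈ A <;> simp [hω]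
      · rw [map_smul]
        exact smul_nonneg c.coe_nonneg (hφ A hA)
      · rw [map_smul, smul_eq_mul, ENNReal.ofReal_mul c.coe_nonneg, ENNReal.ofReal_coe_nnreal]
        rw [show ENNReal.ofReal (φ _) = ν A from (hνA A hA).symm]
        rw [← lintegral_indicator_const hA]
        refine lintegral_congr fun ω => ?_
        by_cases hω : ω ∈ A <;> simp [hω]
    | add hdisj hf hg =>
      obtain ⟨X, hX, hX0, hXν⟩ := hf
      obtain ⟨X', hX', hX'0, hX'ν⟩ := hg
      refine ⟨X + X', ?_, ?_, ?_⟩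
      · filter_upwards [Lp.coeFn_add X X', hX, hX'] with ω h1 h2 h3
        rw [h1, Pi.add_apply, h2, h3]
        simp [add_smul]
      · rw [map_add]; positivity
      · rw [map_add, ENNReal.ofReal_add hX0 hX'0, ← hXν, ← hX'ν,
          ← lintegral_add_left (by fun_prop)]
        simp
  refine ⟨fun ω => (ν.rnDeriv P ω).toReal, memLp_rnDeriv_of_lintegral_le hνP hp
    (‖φ‖₊ * ‖e‖₊) fun s => ?_, fun A hA => ?_⟩
  · obtain ⟨X, hX, hX0, hXν⟩ := hsimple s
    rw [hXν]
    calc ENNReal.ofReal (φ X) ≤ ‖φ X‖ₑ := by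
          rw [Real.enorm_of_nonneg hX0]
      _ ≤ ‖φ‖ₑ * ‖X‖ₑ := φ.le_opENorm X
      _ = ‖φ‖ₑ * (‖e‖ₑ * eLpNorm (fun ω => (s ω : ℝ)) p P) := by
          rw [Lp.enorm_def, eLpNorm_congr_ae hX, ← enorm_norm e,
            ← eLpNorm_const_smul]
          congr 1
          refine eLpNorm_congr_norm_ae (.of_forall fun ω => ?_)
          simp [norm_smul, mul_comm]
      _ = _ := by rw [ENNReal.coe_mul, mul_assoc]; rfl
  · rw [Measure.setIntegral_toReal_rnDeriv hνP, Measure.real, hνA A hA,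
      ENNReal.toReal_ofReal (hφ A hA)]

variable {d : ℕ}

/-- The continuous functional `X ↦ E[Xᵀ Y]` on `L^p_d` for `Y ∈ L^q_d`. -/
noncomputable def pairing [p.HolderConjugate q] [Fact (1 ≤ p)] [Fact (1 ≤ q)] {Y : Ω → Vec d}
    (hY : MemLp Y q P) : Lp (Vec d) p P →L[ℝ] ℝ :=
  ((innerSL ℝ).lpPairing P p q).flip (hY.toLp Y)

theorem pairing_apply [p.HolderConjugate q] [Fact (1 ≤ p)] [Fact (1 ≤ q)] {Y : Ω → Vec d}
    (hY : MemLp Y q P) (X : Lp (Vec d) p P) : pairing hY X = ∫ ω, inner ℝ (X ω) (Y ω) ∂P := by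
  rw [pairing, ContinuousLinearMap.flip_apply, ContinuousLinearMap.lpPairing_eq_integral]
  refine integral_congr_ae ?_
  filter_upwards [hY.coeFn_toLp] with ω hω
  rw [hω, innerSL_apply_apply]

theorem pairing_add_const_smul [p.HolderConjugate q] [Fact (1 ≤ p)] [Fact (1 ≤ q)]
    {Y Y' : Ω → Vec d} (hY : MemLp Y q P) (hY' : MemLp Y' q P) (a : ℝ) (X : Lp (Vec d) p P) :
    pairing (hY.add (hY'.const_smul a)) X = pairing hY X + a * pairing hY' X := by
  rw [pairing, MemLp.toLp_add hY (hY'.const_smul a), MemLp.toLp_const_smul, map_add, map_smul]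
  rfl

/-- Riesz representation of the functionals on `L^p_d`, `p < ∞`, that are nonnegative on the
random vectors with nonnegative components. -/
theorem exists_pairing_eq_of_nonneg [IsFiniteMeasure P] [p.HolderConjugate q]
    [Fact (1 ≤ p)] [Fact (1 ≤ q)] (hp : p ≠ ∞) (φ : Lp (Vec d) p P →L[ℝ] ℝ)
    (hφ : ∀ X ∈ LpIn p P (fun _ => orthant d), 0 ≤ φ X) :
    ∃ (Y : Ω → Vec d) (hY : MemLp Y q P), φ = pairing hY := by
  have hnn : ∀ (i : Fin d) (A : Set Ω) (hA : MeasurableSet A),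
      0 ≤ φ (indicatorConstLp p hA (measure_ne_top P A) (EuclideanSpace.single i (1 : ℝ))) :=
    fun i A hA => by
    refine hφ _ ?_
    filter_upwards [indicatorConstLp_coeFn (p := p) (hs := hA) (hμs := measure_ne_top P A)
      (c := (EuclideanSpace.single i (1 : ℝ)))] with ω hω j
    rw [hω]
    by_cases h : ω ∈ A
    · by_cases hj : j = i <;> simp [h, hj]
    · simp [h]
  choose g hg hgA using fun i => exists_density_of_indicator_nonneg (q := q) hp φ _ (hnn i)
  have hY : MemLp (fun ω => (WithLp.toLp 2 fun i => g i ω : Vec d)) q P :=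
    MemLp.of_eval_piLp fun i => hg i
  refine ⟨_, hY, ContinuousLinearMap.ext fun X => ?_⟩
  induction X using Lp.induction hp with
  | @indicatorConst c A hA hμA =>
    -- Expanding the constant in the standard basis reduces the check to the `d` scalar densities.
    have hc : indicatorConstLp p hA hμA.ne c =
        ∑ i, c i • indicatorConstLp p hA hμA.ne (EuclideanSpace.single i (1 : ℝ)) := by
      let T : Vec d →+ Lp (Vec d) p P := AddMonoidHom.mk' (fun v => indicatorConstLp p hA hμA.ne v)
        fun u v => (indicatorConstLp_add (c := u) (c' := v)).symm
      calc indicatorConstLp p hA hμA.ne c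
          = T (∑ i, c i • (EuclideanSpace.single i (1 : ℝ))) := by
            congr 1
            ext j
            simp [Finset.sum_apply, Pi.single_apply]
        _ = _ := by
            rw [map_sum]
            exact Finset.sum_congr rfl fun i _ => indicatorConstLp_const_smul hA hμA.ne _ _
    have hY' : ∀ i, IntegrableOn (g i) A P := fun i =>
      ((hg i).integrable Fact.out).integrableOn
    change φ (indicatorConstLp p hA hμA.ne c) = pairing hY (indicatorConstLp p hA hμA.ne c)
    rw [pairing_apply, hc, map_sum]
    simp_rw [map_smul, hgA, ← hc]
    calc ∑ i, c i • ∫ ω in A, g i ω ∂P = ∫ ω in A, ∑ i, c i * g i ω ∂P := by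
          rw [integral_finsetSum _ fun i _ => (hY' i).const_mul _]
          simp_rw [integral_const_mul, smul_eq_mul]
      _ = ∫ ω, A.indicator (fun ω => ∑ i, c i * g i ω) ω ∂P := (integral_indicator hA).symm
      _ = _ := by
          refine integral_congr_ae ?_
          filter_upwards [indicatorConstLp_coeFn (p := p) (hs := hA) (hμs := hμA.ne) (c := c)]
            with ω hω
          rw [hω]
          by_cases h : ω ∈ A <;> simp [h, PiLp.inner_apply, mul_comm]
  | add hf hg hdisj h1 h2 => rw [map_add, map_add, h1, h2]
  | isClosed => exact isClosed_eq φ.continuous (pairing hY).continuous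

end Duality

/-! ### Hahn–Banach separation by elements of `L^q_d`. -/

section Separation

open Filter Topology

variable {Ω : Type*} [MeasurableSpace Ω] {P : Measure Ω} {p q : ℝ≥0∞} {d : ℕ}

/-- Closedness in the norm topology for `p < ∞` and in `σ(L^∞_d, L^1_d)` for `p = ∞`. -/
def IsDualClosed [Fact (1 ≤ p)] (A : Set (Lp (Vec d) p P)) : Prop :=
  (p ≠ ∞ → IsClosed A) ∧ (p = ∞ → IsClosed[pairingTopology P d p 1] A)

theorem nonneg_of_forall_le_add_natCast_mul {a b c : ℝ} (h : ∀ n : ℕ, c ≤ a + n * b) : 0 ≤ b := by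
  by_contra! hb
  obtain ⟨n, hn⟩ := exists_nat_gt ((c - a) / b)
  have := h n
  rw [div_lt_iff_of_neg hb] at hn
  linarith

/-- A functional bounded below on a nonempty set is nonnegative on its directions of recession. -/
theorem nonneg_of_bddBelow_of_add_mem {V : Type*} [AddCommGroup V] [Module ℝ V] (φ : V →ₗ[ℝ] ℝ)
    {A : Set V} (hne : A.Nonempty) {c : ℝ} (hc : ∀ x ∈ A, c ≤ φ x) {z : V}
    (hz : ∀ x ∈ A, x + z ∈ A) : 0 ≤ φ z := by
  obtain ⟨x, hx⟩ := hne
  have hmem : ∀ n : ℕ, x + (n : ℝ) • z ∈ A := fun n => by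
    induction n with
    | zero => simpa using hx
    | succ n ih =>
      have := hz _ ih
      simpa [add_smul, add_assoc] using this
  refine nonneg_of_forall_le_add_natCast_mul (a := φ x) (c := c) fun n => ?_
  simpa using hc _ (hmem n)

/-- Needed for `p = ∞`: in a weak topology of a bilinear form, the space is locally convex and every
continuous functional is itself a pairing. -/
theorem pairingTopology_eq_weakBilin [p.HolderConjugate q] [Fact (1 ≤ p)] [Fact (1 ≤ q)] :
    pairingTopology P d p q = WeakBilin.instTopologicalSpace
      (((ContinuousLinearMap.coeLM ℝ).comp
        ((innerSL ℝ (E := Vec d)).lpPairing P p q).toLinearMap :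
          Lp (Vec d) p P →ₗ[ℝ] Lp (Vec d) q P →ₗ[ℝ] ℝ)) := by
  have : (fun (X : Lp (Vec d) p P) (Y : Lp (Vec d) q P) => ∫ ω, inner ℝ (X ω) (Y ω) ∂P) =
      fun X Y => (innerSL ℝ (E := Vec d)).lpPairing P p q X Y := by
    funext X Y
    rw [ContinuousLinearMap.lpPairing_eq_integral]
    rfl
  rw [pairingTopology, this]
  rfl

/-- A closed convex upper set in `L^p_d` and a point outside it are strictly separated by an
element of `L^q_d`. -/
theorem exists_pairing_separation [IsFiniteMeasure P] [hpq : p.HolderConjugate q]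
    [Fact (1 ≤ p)] [Fact (1 ≤ q)] {A : Set (Lp (Vec d) p P)} (hconv : Convex ℝ A)
    (hcl : IsDualClosed A) (hne : A.Nonempty)
    (hadd : ∀ X ∈ A, ∀ Z ∈ LpIn p P (fun _ => orthant d), X + Z ∈ A)
    {X : Lp (Vec d) p P} (hX : X ∉ A) :
    ∃ (Y : Ω → Vec d) (hY : MemLp Y q P) (c : ℝ), pairing (p := p) hY X < c ∧
      ∀ X' ∈ A, c ≤ pairing hY X' := by
  by_cases hp : p = ∞
  · subst hp
    obtain rfl : q = 1 := by simpa using hpq.inv_add_inv_eq_inv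
    have hcl' := hcl.2 rfl
    rw [pairingTopology_eq_weakBilin] at hcl'
    set B := (ContinuousLinearMap.coeLM ℝ).comp
        ((innerSL ℝ (E := Vec d)).lpPairing P ∞ 1).toLinearMap with hB
    obtain ⟨f, u, hfu, hfA⟩ := geometric_hahn_banach_point_closed (E := WeakBilin B)
      (t := A) hconv hcl' hX
    -- Here the dual is `L^1` by construction, so no Riesz theorem and no positivity are needed.
    obtain ⟨Y, rfl⟩ := LinearMap.dualEmbedding_surjective B f
    have hval : ∀ X', pairing (Lp.memLp Y) X' = B X' Y := fun X' => by
      rw [pairing_apply, hB]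
      exact ((innerSL ℝ).lpPairing_eq_integral X' Y).symm
    refine ⟨Y, Lp.memLp Y, u, ?_, fun X' hX' => ?_⟩
    · rw [hval]; exact hfu
    · rw [hval]; exact (hfA X' hX').le
  · obtain ⟨f, u, hfu, hfA⟩ := geometric_hahn_banach_point_closed hconv (hcl.1 hp) hX
    -- For `p < ∞`, the functional is positive because it is bounded below on a set stable under
    -- adding nonnegative vectors.
    obtain ⟨Y, hY, rfl⟩ := exists_pairing_eq_of_nonneg (q := q) hp f fun Z hZ =>
      nonneg_of_bddBelow_of_add_mem f.toLinearMap hne (fun x hx => (hfA x hx).le)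
        fun x hx => hadd x hx Z hZ
    exact ⟨Y, hY, u, hfu, fun X' hX' => (hfA X' hX').le⟩

end Separation

/-! ### The weight set and half-spaces of `M`. -/

section Cones

variable {d : ℕ} {M : Submodule ℝ (Vec d)} {KI : ProperCone ℝ (Vec d)}

theorem zero_mem_eligibleCone : (0 : Vec d) ∈ eligibleCone KI M :=
  ⟨KI.zero_mem, M.zero_mem⟩

/-- As `0 ∈ K_I^M`, the inclusion `D + K_I^M ⊆ D` is automatically an equality, which removes the
sum from the definition. -/
theorem mem_GM_iff {D : Set (Vec d)} :
    D ∈ GM KI M ↔ IsClosed D ∧ Convex ℝ D ∧ D + eligibleCone KI M ⊆ D := by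
  constructor
  · intro h
    refine ⟨?_, ?_, ?_⟩
    · rw [show D = _ from h]; exact isClosed_closure
    · rw [show D = _ from h]; exact (convex_convexHull ℝ _).closure
    · conv_rhs => rw [show D = _ from h]
      exact (subset_convexHull ℝ _).trans subset_closure
  · rintro ⟨hcl, hconv, hadd⟩
    have : D + eligibleCone KI M = D :=
      hadd.antisymm fun x hx => ⟨x, hx, 0, zero_mem_eligibleCone, add_zero x⟩
    change D = _
    rw [this, hconv.convexHull_eq, hcl.closure_eq]

/-- The vectors in `K_I^+ \ M^⊥ + M^⊥` are those of the dual cone of `K_I^M` outside `M^⊥`. -/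
theorem mem_weightSet_iff
    (hKIM : IsClosed ((ProperCone.innerDual (KI : Set (Vec d)) : Set (Vec d))
      + (Mᗮ : Set (Vec d)))) {w : Vec d} :
    w ∈ weightSet M KI ↔ w ∉ Mᗮ ∧ ∀ x ∈ eligibleCone KI M, 0 ≤ inner ℝ w x := by
  constructor
  · rintro ⟨k, ⟨hk, hkM⟩, m, hm, rfl⟩
    refine ⟨fun h => hkM ?_, fun x hx => ?_⟩
    · simpa using Mᗮ.sub_mem h hm
    · rw [inner_add_left, real_inner_comm, real_inner_comm x m,
        Submodule.inner_right_of_mem_orthogonal hx.2 hm, add_zero]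
      exact hk hx.1
  · rintro ⟨hwM, hw⟩
    let S : ProperCone ℝ (Vec d) :=
      { toSubmodule := (ProperCone.innerDual (KI : Set (Vec d))).toSubmodule ⊔
          Mᗮ.restrictScalars _
        isClosed' := by
          convert hKIM using 1
          exact Submodule.coe_sup _ _ }
    have hS : (S : Set (Vec d)) = (ProperCone.innerDual (KI : Set (Vec d)) : Set (Vec d))
        + (Mᗮ : Set (Vec d)) := Submodule.coe_sup _ _
    -- Bipolar argument: a vector `x` separating `w` from `K_I^+ + M^⊥` lies in `K_I` (take the
    -- `M^⊥` part zero) and in `M` (test with `±m`), contradicting nonnegativity of `w` on `K_I^M`.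
    have hwS : w ∈ (S : Set (Vec d)) := by
      by_contra h
      obtain ⟨x, hx, hxw⟩ := S.hyperplane_separation' h
      have hx' : ∀ k ∈ ProperCone.innerDual (KI : Set (Vec d)), ∀ m ∈ Mᗮ, 0 ≤ inner ℝ (k + m) x :=
        fun k hk m hm => hx _ (by
          change _ ∈ (S : Set (Vec d))
          rw [hS]; exact ⟨k, hk, m, hm, rfl⟩)
      have hxK : x ∈ KI := by
        rw [← ProperCone.innerDual_innerDual KI]
        intro k hk
        simpa using hx' k hk 0 (Submodule.zero_mem _)
      have hxM : x ∈ M := by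
        rw [← Submodule.orthogonal_orthogonal M, Submodule.mem_orthogonal]
        intro m hm
        have h1 := hx' 0 (Submodule.zero_mem _) m hm
        have h2 := hx' 0 (Submodule.zero_mem _) (-m) (Submodule.neg_mem _ hm)
        simp only [zero_add, inner_neg_left] at h1 h2
        linarith
      exact absurd (hw x ⟨hxK, hxM⟩) (not_le.2 hxw)
    rw [hS] at hwS
    obtain ⟨k, hk, m, hm, rfl⟩ := hwS
    exact ⟨k, ⟨hk, fun h => hwM (Submodule.add_mem _ h hm)⟩, m, hm, rfl⟩

/-- The vectors `u ∈ M` with `c ≤ wᵀ u`. -/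
def halfIn (M : Submodule ℝ (Vec d)) (w : Vec d) (c : ℝ) : Set (Vec d) :=
  {u | u ∈ M ∧ c ≤ inner ℝ w u}

theorem halfIn_subset (w : Vec d) (c : ℝ) : halfIn M w c ⊆ M := fun _ hu => hu.1

theorem isClosed_halfIn (w : Vec d) (c : ℝ) : IsClosed (halfIn M w c) :=
  have h : IsClosed {u : Vec d | c ≤ inner ℝ w u} :=
    isClosed_le continuous_const (by fun_prop)
  M.closed_of_finiteDimensional.inter h

theorem convex_halfIn (w : Vec d) (c : ℝ) : Convex ℝ (halfIn M w c) :=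
  M.convex.inter (convex_halfSpace_ge (innerₗ (Vec d) w).isLinear c)

/-- A functional that does not vanish on `M` maps `M` onto `ℝ`. This is the only role of `w ∉ M^⊥`
in the calculus of half-spaces below. -/
theorem exists_inner_eq {w : Vec d} (hw : w ∉ Mᗮ) (c : ℝ) : ∃ u ∈ M, inner ℝ w u = c := by
  rw [Submodule.mem_orthogonal'] at hw
  push Not at hw
  obtain ⟨v, hv, hwv⟩ := hw
  exact ⟨(c / inner ℝ w v) • v, M.smul_mem _ hv, by
    rw [real_inner_smul_right, div_mul_cancel₀ _ hwv]⟩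

theorem halfIn_nonempty {w : Vec d} (hw : w ∉ Mᗮ) (c : ℝ) : (halfIn M w c).Nonempty := by
  obtain ⟨u, hu, h⟩ := exists_inner_eq hw c
  exact ⟨u, hu, h.ge⟩

theorem halfIn_ne_coe {w : Vec d} (hw : w ∉ Mᗮ) (c : ℝ) : halfIn M w c ≠ M := by
  obtain ⟨u, hu, h⟩ := exists_inner_eq hw (c - 1)
  intro he
  have : u ∈ halfIn M w c := he ▸ hu
  linarith [this.2]

/-- Any `u` in the right-hand side splits off a vector of `M` whose value is exactly `a`. This turns
Minkowski sums in the representation into sums of numbers. -/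
theorem halfIn_add_halfIn {w : Vec d} (hw : w ∉ Mᗮ) (a b : ℝ) :
    halfIn M w a + halfIn M w b = halfIn M w (a + b) := by
  ext u
  constructor
  · rintro ⟨x, hx, y, hy, rfl⟩
    refine ⟨M.add_mem hx.1 hy.1, ?_⟩
    rw [inner_add_right]
    exact add_le_add hx.2 hy.2
  · rintro ⟨hu, hab⟩
    obtain ⟨x, hx, h⟩ := exists_inner_eq hw a
    refine ⟨x, ⟨hx, h.ge⟩, u - x, ⟨M.sub_mem hu hx, ?_⟩, by simp⟩
    rw [inner_sub_right, h]
    linarith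

theorem coe_add_halfIn {w : Vec d} (hw : w ∉ Mᗮ) (b : ℝ) :
    (M : Set (Vec d)) + halfIn M w b = M := by
  ext u
  constructor
  · rintro ⟨x, hx, y, hy, rfl⟩
    exact M.add_mem hx hy.1
  · intro hu
    obtain ⟨x, hx⟩ := halfIn_nonempty hw b
    exact ⟨u - x, M.sub_mem hu hx.1, x, hx, by simp⟩

/-- The closure of a nonempty subset of `M` that is an upper set in the direction `w` is `M` or a
half-space in `M`. -/
theorem closure_eq_coe_or_eq_halfIn {w : Vec d} (hw : w ∉ Mᗮ) {D : Set (Vec d)} (hD : D ⊆ M)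
    (hne : D.Nonempty) (hup : ∀ a ∈ D, ∀ u ∈ M, inner ℝ w a ≤ inner ℝ w u → u ∈ D) :
    closure D = M ∨ ∃ c, closure D = halfIn M w c := by
  by_cases hbd : BddBelow ((fun a => inner ℝ w a) '' D)
  · right
    have hglb := isGLB_csInf (hne.image _) hbd
    have hle : D ⊆ halfIn M w (sInf ((fun a => inner ℝ w a) '' D)) := fun u hu =>
      ⟨hD hu, hglb.1 (mem_image_of_mem _ hu)⟩
    refine ⟨_, (closure_minimal hle (isClosed_halfIn w _)).antisymm ?_⟩
    rintro u ⟨huM, hu⟩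
    -- Moving from `u` along `e` raises its value strictly above the infimum, hence into `D`; then
    -- let the step tend to `0`.
    obtain ⟨e, he, hwe⟩ := exists_inner_eq hw 1
    have htend : Filter.Tendsto (fun t : ℝ => u + t • e) (nhdsWithin 0 (Ioi 0)) (nhds u) := by
      have : Continuous fun t : ℝ => u + t • e := by fun_prop
      simpa using (this.tendsto 0).mono_left nhdsWithin_le_nhds
    refine mem_closure_of_tendsto htend ?_
    filter_upwards [self_mem_nhdsWithin] with t ht
    have ht : 0 < t := ht
    have hlt : sInf ((fun a => inner ℝ w a) '' D) < inner ℝ w (u + t • e) := by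
      rw [inner_add_right, real_inner_smul_right, hwe]
      linarith
    obtain ⟨_, ⟨a, ha, rfl⟩, hav⟩ := (isGLB_lt_iff hglb).1 hlt
    exact hup a ha _ (M.add_mem huM (M.smul_mem _ he)) hav.le
  · left
    refine (closure_minimal hD M.closed_of_finiteDimensional).antisymm fun u hu =>
      subset_closure ?_
    rw [not_bddBelow_iff] at hbd
    obtain ⟨_, ⟨a, ha, rfl⟩, hau⟩ := hbd (inner ℝ w u)
    exact hup a ha u hu hau.le

theorem closure_halfIn_add_halfSpace_inter (w : Vec d) (c : ℝ) :
    closure (halfIn M w c + halfSpace w) ∩ M = halfIn M w c := by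
  refine Subset.antisymm ?_ fun u hu => ⟨subset_closure ⟨u, hu, 0, ?_, add_zero u⟩, hu.1⟩
  · rintro u ⟨hu, huM⟩
    refine ⟨huM, ?_⟩
    have hcl : IsClosed {x : Vec d | c ≤ inner ℝ w x} :=
      isClosed_le continuous_const (by fun_prop)
    refine closure_minimal ?_ hcl hu
    rintro _ ⟨x, hx, y, hy, rfl⟩
    have h1 := hx.2
    have h2 : 0 ≤ inner ℝ w y := hy
    simp only [mem_ofPred_eq, inner_add_right]
    linarith
  · simp [halfSpace]

theorem closure_coe_add_halfSpace_inter (w : Vec d) :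
    closure ((M : Set (Vec d)) + halfSpace w) ∩ M = M :=
  Subset.antisymm inter_subset_right fun u hu =>
    ⟨subset_closure ⟨u, hu, 0, by simp [halfSpace], add_zero u⟩, hu⟩

theorem halfIn_mem_GM {w : Vec d} (hw : ∀ x ∈ eligibleCone KI M, 0 ≤ inner ℝ w x) (c : ℝ) :
    halfIn M w c ∈ GM KI M := by
  refine mem_GM_iff.2 ⟨isClosed_halfIn w c, convex_halfIn w c, ?_⟩
  rintro _ ⟨x, hx, y, hy, rfl⟩
  refine ⟨M.add_mem hx.1 hy.2, ?_⟩
  rw [inner_add_right]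
  linarith [hx.2, hw y hy]

theorem coe_mem_GM : (M : Set (Vec d)) ∈ GM KI M := by
  refine mem_GM_iff.2 ⟨M.closed_of_finiteDimensional, M.convex, ?_⟩
  rintro _ ⟨x, hx, y, hy, rfl⟩
  exact M.add_mem hx hy.2

end Cones

/-! ### From elements of `L^q_d` to pairs `(Q, w)` and back. -/

section DualVariables

open Filter Topology

variable {Ω : Type*} [MeasurableSpace Ω] {P : Measure Ω} {p q : ℝ≥0∞} {d : ℕ}
  {M : Submodule ℝ (Vec d)} {KI : ProperCone ℝ (Vec d)} {KT : Ω → ProperCone ℝ (Vec d)}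

/-- A point lies in a closed set exactly when every ball of radius `1 / (n + 1)` around it meets the
set. Constants can then be cut off to the event where they lie in `K_T`. -/
theorem measurableSet_mem_of_isMeasurableSetValued
    (hKT : IsMeasurableSetValued fun ω => (KT ω : Set (Vec d))) (x : Vec d) :
    MeasurableSet {ω | x ∈ KT ω} := by
  have : {ω | x ∈ KT ω} =
      ⋂ n : ℕ, {ω | ((KT ω : Set (Vec d)) ∩ Metric.ball x (1 / (n + 1))).Nonempty} := by
    ext ω
    simp only [mem_iInter]
    constructor
    · intro hx n
      exact ⟨x, hx, Metric.mem_ball_self (by positivity)⟩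
    · intro h
      change x ∈ (KT ω : Set (Vec d))
      rw [← (KT ω).isClosed.closure_eq, Metric.mem_closure_iff]
      intro ε hε
      obtain ⟨n, hn⟩ := exists_nat_one_div_lt hε
      obtain ⟨y, hy, hyx⟩ := h n
      exact ⟨y, hy, (by rw [dist_comm]; exact (Metric.mem_ball.1 hyx).trans hn)⟩
  rw [this]
  exact MeasurableSet.iInter fun n => hKT _ Metric.isOpen_ball

theorem interior_orthant_nonempty : (interior (orthant d)).Nonempty := by
  refine ⟨WithLp.toLp 2 fun _ => 1, ?_⟩
  rw [mem_interior]
  refine ⟨⋂ i, {x : Vec d | 0 < x i}, fun x hx i => (mem_iInter.1 hx i).le,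
    isOpen_iInter_of_finite fun i => isOpen_lt continuous_const (by fun_prop), ?_⟩
  simp

/-- An element of `L^q_d` that is nonnegative on `L^p_d(K_T)` takes values in `K_T^+`. -/
theorem ae_mem_innerDual [IsFiniteMeasure P] [p.HolderConjugate q] [Fact (1 ≤ p)] [Fact (1 ≤ q)]
    (hKT : IsMeasurableSetValued fun ω => (KT ω : Set (Vec d)))
    (hKT' : ∀ ω, orthant d ⊆ (KT ω : Set (Vec d))) {Y : Ω → Vec d} (hY : MemLp Y q P)
    (h : ∀ X ∈ LpIn p P (fun ω => (KT ω : Set (Vec d))), 0 ≤ pairing hY X) :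
    ∀ᵐ ω ∂P, Y ω ∈ ProperCone.innerDual (KT ω : Set (Vec d)) := by
  -- For fixed `x`, the vectors `x 1_{s ∩ A}` belong to `L^p_d(K_T)`, so `xᵀY ≥ 0` a.s. on `A`.
  -- Countably many `x` share one null set.
  have hdense : ∀ n : ℕ, ∀ᵐ ω ∂P, TopologicalSpace.denseSeq (Vec d) n ∈ KT ω →
      0 ≤ inner ℝ (TopologicalSpace.denseSeq (Vec d) n) (Y ω) := fun n => by
    set x := TopologicalSpace.denseSeq (Vec d) n
    have hA := measurableSet_mem_of_isMeasurableSetValued hKT x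
    set A := {ω | x ∈ KT ω}
    have hint : Integrable (fun ω => inner ℝ x (Y ω)) P :=
      (hY.integrable Fact.out).const_inner x
    have key : 0 ≤ᵐ[P.restrict A] fun ω => inner ℝ x (Y ω) := by
      refine ae_nonneg_restrict_of_forall_setIntegral_nonneg_inter hint.integrableOn
        fun s hs _ => ?_
      have hsA := hs.inter hA
      have := h (indicatorConstLp p hsA (measure_ne_top P _) x) ?_
      · rw [pairing_apply] at this
        rw [← integral_indicator hsA]
        refine this.trans_eq (integral_congr_ae ?_)
        filter_upwards [indicatorConstLp_coeFn (p := p) (hs := hsA)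
          (hμs := measure_ne_top P _) (c := x)] with ω hω
        rw [hω]
        by_cases hω : ω ∈ s ∩ A
        · rw [indicator_of_mem hω, indicator_of_mem hω]
        · rw [indicator_of_notMem hω, indicator_of_notMem hω, inner_zero_left]
      · filter_upwards [indicatorConstLp_coeFn (p := p) (hs := hsA)
          (hμs := measure_ne_top P _) (c := x)] with ω hω
        rw [hω]
        by_cases hω : ω ∈ s ∩ A
        · rw [indicator_of_mem hω]; exact hω.2
        · rw [indicator_of_notMem hω]; exact (KT ω).zero_mem
    exact (ae_restrict_iff' hA).1 key
  filter_upwards [ae_all_iff.2 hdense] with ω hω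
  intro x hx
  by_contra! hneg
  set K := (KT ω : Set (Vec d))
  have hKne : (interior K).Nonempty :=
    interior_orthant_nonempty.mono (interior_mono (hKT' ω))
  -- A dense sequence of `ℝ^d` may miss a thin cone. Here `K` contains the orthant, so it is the
  -- closure of its interior, and a violation at `x` would persist at a dense point inside `K`.
  have hxcl : x ∈ closure (interior K) := by
    rw [(KT ω).convex.closure_interior_eq_closure_of_nonempty_interior hKne]
    exact subset_closure hx
  have hopen : IsOpen {y : Vec d | inner ℝ y (Y ω) < 0} :=
    isOpen_lt (by fun_prop) continuous_const
  have hne : (interior K ∩ {y : Vec d | inner ℝ y (Y ω) < 0}).Nonempty := by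
    rw [inter_comm]
    exact mem_closure_iff.1 hxcl _ hopen hneg
  obtain ⟨y, hy, n, rfl⟩ :=
    (TopologicalSpace.denseRange_denseSeq (Vec d)).inter_open_nonempty _
      (isOpen_interior.inter hopen) hne
  exact absurd (hω n (interior_subset hy.1)) (not_le.2 hy.2)

theorem pairing_nonneg_of_ae_mem_innerDual [p.HolderConjugate q] [Fact (1 ≤ p)] [Fact (1 ≤ q)]
    {Y : Ω → Vec d} (hY : MemLp Y q P)
    (h : ∀ᵐ ω ∂P, Y ω ∈ ProperCone.innerDual (KT ω : Set (Vec d))) {X : Lp (Vec d) p P}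
    (hX : X ∈ LpIn p P (fun ω => (KT ω : Set (Vec d)))) : 0 ≤ pairing hY X := by
  rw [pairing_apply]
  refine integral_nonneg_of_ae ?_
  filter_upwards [h, hX] with ω h1 h2
  exact h1 h2

/-- The pairing of `X` with the density `diag(w) dQ/dP`. -/
noncomputable def scalarize (z : (Fin d → Measure Ω) × Vec d) (X : Lp (Vec d) p P) : ℝ :=
  ∫ ω, inner ℝ (X ω) (density P z.1 z.2 ω) ∂P

section

variable [p.HolderConjugate q] {z : (Fin d → Measure Ω) × Vec d}

theorem scalarize_eq_pairing [Fact (1 ≤ p)] [Fact (1 ≤ q)] (hz : MemLp (density P z.1 z.2) q P) (X : Lp (Vec d) p P) :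
    scalarize z X = pairing hz X :=
  (pairing_apply hz X).symm

variable [IsProbabilityMeasure P]

/-- `wᵀ E^Q[X] = E[Xᵀ diag(w) dQ/dP]`. -/
theorem inner_expect (hQ : z.1 ∈ vecProb P d) (hz : MemLp (density P z.1 z.2) q P)
    (X : Lp (Vec d) p P) : inner ℝ z.2 (expect z.1 X) = scalarize z X := by
  have hint : ∀ i, Integrable (fun ω => density P z.1 z.2 ω i * X ω i) P := fun i =>
    memLp_one_iff_integrable.1
      (((Lp.memLp X).eval_piLp i).mul (hpqr := ENNReal.HolderTriple.symm) (hz.eval_piLp i))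
  -- When `w i = 0` both sides vanish, whether or not `X i` is integrable under `Q i`.
  have hE : ∀ i, z.2 i * ∫ ω, X ω i ∂(z.1 i) = ∫ ω, density P z.1 z.2 ω i * X ω i ∂P := fun i => by
    have := (hQ i).1
    rw [← integral_toReal_rnDeriv_mul (hQ i).2, ← integral_const_mul]
    simp [density, mul_assoc]
  calc inner ℝ z.2 (expect z.1 X) = ∑ i, z.2 i * ∫ ω, X ω i ∂(z.1 i) := by
        simp [PiLp.inner_apply, expect, mul_comm]
    _ = ∫ ω, ∑ i, density P z.1 z.2 ω i * X ω i ∂P := by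
        rw [integral_finsetSum _ fun i _ => hint i]
        exact Finset.sum_congr rfl fun i _ => hE i
    _ = scalarize z X := by simp [scalarize, PiLp.inner_apply]

theorem scalarize_const (hQ : z.1 ∈ vecProb P d) (hz : MemLp (density P z.1 z.2) q P)
    (u : Vec d) : scalarize z (Lp.const p P u) = inner ℝ z.2 u := by
  rw [← inner_expect (q := q) hQ hz]
  congr 1
  ext i
  have := (hQ i).1
  simp [expect]

theorem expectSet_eq_halfIn (hQ : z.1 ∈ vecProb P d) (hz : MemLp (density P z.1 z.2) q P)
    (X : Lp (Vec d) p P) : expectSet M z X = halfIn M z.2 (scalarize z X) := by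
  ext u
  rw [← inner_expect (q := q) hQ hz]
  constructor
  · rintro ⟨⟨_, rfl, y, hy, rfl⟩, hu⟩
    refine ⟨hu, ?_⟩
    have : 0 ≤ inner ℝ z.2 y := hy
    rw [inner_add_right]
    linarith
  · rintro ⟨hu, h⟩
    refine ⟨⟨_, rfl, u - expect z.1 X, ?_, by simp⟩, hu⟩
    change 0 ≤ inner ℝ z.2 (u - expect z.1 X)
    rw [inner_sub_right]
    linarith

end

theorem pairing_const [IsFiniteMeasure P] [p.HolderConjugate q] [Fact (1 ≤ p)] [Fact (1 ≤ q)]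
    {Y : Ω → Vec d} (hY : MemLp Y q P) (u : Vec d) :
    pairing hY (Lp.const p P u) = inner ℝ (∫ ω, Y ω ∂P) u := by
  rw [pairing_apply, real_inner_comm, ← integral_inner (hY.integrable Fact.out)]
  refine integral_congr_ae ?_
  filter_upwards [Lp.coeFn_const (p := p) (μ := P) (c := u)] with ω hω
  rw [hω, Function.const_apply]

/-- Every integrable random vector with nonnegative components is of the form `diag(w) dQ/dP`. -/
theorem exists_density_ae_eq [IsProbabilityMeasure P] {Y : Ω → Vec d} (hY : Integrable Y P)
    (hY0 : ∀ᵐ ω ∂P, Y ω ∈ orthant d) :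
    ∃ Q ∈ vecProb P d, density P Q (∫ ω, Y ω ∂P) =ᵐ[P] Y := by
  set w := ∫ ω, Y ω ∂P
  have hYi : ∀ i, Integrable (fun ω => Y ω i) P := fun i => hY.eval_piLp i
  have hwi : ∀ i, w i = ∫ ω, Y ω i ∂P := fun i => eval_integral_piLp hYi i
  have hYi0 : ∀ i, 0 ≤ᵐ[P] fun ω => Y ω i := fun i => by
    filter_upwards [hY0] with ω hω
    exact hω i
  have hQ : ∀ i, ∃ Q : Measure Ω, (IsProbabilityMeasure Q ∧ Q ≪ P) ∧
      (fun ω => w i * (Q.rnDeriv P ω).toReal) =ᵐ[P] fun ω => Y ω i := fun i => by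
    have hwi0 : 0 ≤ w i := by
      rw [hwi]; exact integral_nonneg_of_ae (hYi0 i)
    -- A component of mean zero vanishes a.s., so any probability measure serves and `P` is taken;
    -- otherwise `Y i / w i` is a probability density.
    rcases hwi0.eq_or_lt' with h0 | hpos
    · refine ⟨P, ⟨inferInstance, Measure.AbsolutelyContinuous.rfl⟩, ?_⟩
      have := (integral_eq_zero_iff_of_nonneg_ae (hYi0 i) (hYi i)).1 ((hwi i).symm.trans h0)
      filter_upwards [this] with ω hω
      simpa [h0] using hω.symm
    · have hm : AEMeasurable (fun ω => ENNReal.ofReal (Y ω i / w i)) P :=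
        ((hYi i).div_const _).aemeasurable.ennreal_ofReal
      refine ⟨P.withDensity fun ω => ENNReal.ofReal (Y ω i / w i),
        ⟨⟨?_⟩, withDensity_absolutelyContinuous _ _⟩, ?_⟩
      · rw [withDensity_apply _ MeasurableSet.univ, Measure.restrict_univ,
          ← ofReal_integral_eq_lintegral_ofReal ((hYi i).div_const _), integral_div, ← hwi,
          div_self hpos.ne', ENNReal.ofReal_one]
        filter_upwards [hYi0 i] with ω hω
        exact div_nonneg hω hwi0
      · filter_upwards [Measure.rnDeriv_withDensity₀ P hm, hYi0 i] with ω h1 h2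
        rw [h1, ENNReal.toReal_ofReal (div_nonneg h2 hwi0), mul_div_cancel₀ _ hpos.ne']
  choose Q hQ1 hQ2 using hQ
  refine ⟨Q, hQ1, ?_⟩
  filter_upwards [ae_all_iff.2 hQ2] with ω hω
  ext i
  exact hω i

theorem innerDual_subset_orthant {K : Set (Vec d)} (hK : orthant d ⊆ K) {y : Vec d}
    (hy : y ∈ ProperCone.innerDual K) : y ∈ orthant d := fun i => by
  have : (EuclideanSpace.single i (1 : ℝ) : Vec d) ∈ orthant d := fun j => by
    by_cases hj : j = i <;> simp [hj]
  simpa [PiLp.inner_apply, Pi.single_apply] using hy (hK this)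

end DualVariables

/-! ### Maps given by systems of scalar inequalities. -/

section HalfSpaceFamilies

open Topology

variable {Ω : Type*} [MeasurableSpace Ω] {P : Measure Ω} {p q : ℝ≥0∞} {d : ℕ}
  {M : Submodule ℝ (Vec d)} {KI : ProperCone ℝ (Vec d)} {KT : Ω → ProperCone ℝ (Vec d)}

theorem continuous_pairing_pairingTopology [p.HolderConjugate q] [Fact (1 ≤ p)] [Fact (1 ≤ q)]
    {Y : Ω → Vec d} (hY : MemLp Y q P) :
    @Continuous _ _ (pairingTopology P d p q) _ fun X : Lp (Vec d) p P => pairing hY X := by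
  let _ := pairingTopology P d p q
  have h1 : Continuous fun (X : Lp (Vec d) p P) (Y : Lp (Vec d) q P) =>
      ∫ ω, inner ℝ (X ω) (Y ω) ∂P := continuous_induced_dom
  have h2 := (continuous_apply (hY.toLp Y)).comp h1
  refine h2.congr fun X => ?_
  rw [pairing_apply]
  refine integral_congr_ae ?_
  filter_upwards [hY.coeFn_toLp] with ω hω
  rw [hω]

theorem isClosed_acceptanceSet_of_isClosed_graph (τ : TopologicalSpace (Lp (Vec d) p P))
    {R : Lp (Vec d) p P → Set (Vec d)} (h : IsClosed (graph R)) :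
    IsClosed[τ] (acceptanceSet R) :=
  IsClosed.preimage (f := fun X : Lp (Vec d) p P => (X, (0 : Vec d))) (by fun_prop) h

theorem IsClosedMap.isDualClosed_acceptanceSet [Fact (1 ≤ p)]
    {R : Lp (Vec d) p P → Set (Vec d)} (h : IsClosedMap R) : IsDualClosed (acceptanceSet R) :=
  ⟨fun hp => isClosed_acceptanceSet_of_isClosed_graph _ (h.1 hp),
    fun hp => isClosed_acceptanceSet_of_isClosed_graph _ (h.2 hp)⟩

variable {ι : Type*} {z : ι → (Fin d → Measure Ω) × Vec d} {c : ι → ℝ}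
  {R : Lp (Vec d) p P → Set (Vec d)}

/-- The graph is an intersection of closed conditions. The topology is a parameter so that the norm
and the weak case share one proof. -/
theorem isClosed_graph_of_mem_iff (τ : TopologicalSpace (Lp (Vec d) p P))
    (hR : ∀ X u, u ∈ R X ↔ u ∈ M ∧ ∀ i, c i ≤ inner ℝ (z i).2 u + scalarize (z i) X)
    (hcont : ∀ i, @Continuous _ _ τ _ fun X : Lp (Vec d) p P => scalarize (z i) X) :
    IsClosed (graph R) := by
  have : graph R = {y | y.2 ∈ (M : Set (Vec d))} ∩
      ⋂ i, {y | c i ≤ inner ℝ (z i).2 y.2 + scalarize (z i) y.1} := by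
    ext y
    simp only [mem_inter_iff, mem_iInter]
    exact hR y.1 y.2
  rw [this]
  refine (M.closed_of_finiteDimensional.preimage continuous_snd).inter
    (isClosed_iInter fun i => isClosed_le continuous_const ?_)
  exact (continuous_const.inner continuous_snd).add ((hcont i).comp continuous_fst)

/-- A map described by a family of half-spaces with normals in `𝓦^q` is a closed convex
market-compatible risk measure. -/
theorem isClosedConvexRiskMeasure_of_mem_iff [IsProbabilityMeasure P] [hpq : p.HolderConjugate q]
    [Fact (1 ≤ p)] [Fact (1 ≤ q)]
    (hKIM : IsClosed ((ProperCone.innerDual (KI : Set (Vec d)) : Set (Vec d))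
      + (Mᗮ : Set (Vec d))))
    (hKT' : ∀ ω, orthant d ⊆ (KT ω : Set (Vec d))) [Nonempty ι]
    (hz : ∀ i, z i ∈ Wq P q M KI KT)
    (hR : ∀ X u, u ∈ R X ↔ u ∈ M ∧ ∀ i, c i ≤ inner ℝ (z i).2 u + scalarize (z i) X)
    (h0 : (R 0).Nonempty) : IsClosedConvexRiskMeasure M KI KT R := by
  have hpair : ∀ i X, scalarize (z i) X = pairing (p := p) (hz i).2.2.1 X := fun i X =>
    scalarize_eq_pairing (hz i).2.2.1 X
  have hw := fun i => (mem_weightSet_iff hKIM).1 (hz i).2.1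
  have hadd : ∀ X, ∀ x ∈ R X, ∀ y ∈ eligibleCone KI M, x + y ∈ R X := fun X x hx y hy => by
    rw [hR] at hx ⊢
    refine ⟨M.add_mem hx.1 hy.2, fun i => ?_⟩
    rw [inner_add_right]
    linarith [hx.2 i, (hw i).2 y hy]
  have hmono : IsMonotoneWrt (LpIn p P fun ω => (KT ω : Set (Vec d))) R :=
    fun X₁ X₂ hX u hu => by
    rw [hR] at hu ⊢
    refine ⟨hu.1, fun i => ?_⟩
    have := pairing_nonneg_of_ae_mem_innerDual (hz i).2.2.1 (hz i).2.2.2 hX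
    rw [map_sub, ← hpair, ← hpair] at this
    linarith [hu.2 i]
  have hconv : IsConvexMap R := fun X X' t ht0 ht1 => by
    rintro _ ⟨_, ⟨x, hx, rfl⟩, _, ⟨y, hy, rfl⟩, rfl⟩
    rw [hR] at hx hy
    refine (hR _ _).2 ⟨M.add_mem (M.smul_mem _ hx.1) (M.smul_mem _ hy.1), fun i => ?_⟩
    have hx' := mul_le_mul_of_nonneg_left (hx.2 i) ht0.le
    have hy' := mul_le_mul_of_nonneg_left (hy.2 i) (sub_nonneg.2 ht1.le)
    simp only [hpair, map_add, map_smul, inner_add_right, real_inner_smul_right, smul_eq_mul]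
      at hx' hy' ⊢
    linarith
  have hclosed : ∀ X, IsClosed (R X) := fun X => by
    have : R X = ⋂ i, halfIn M (z i).2 (c i - scalarize (z i) X) := by
      ext u
      simp only [hR, mem_iInter, halfIn, mem_ofPred_eq, sub_le_iff_le_add, forall_and,
        forall_const]
    rw [this]
    exact isClosed_iInter fun i => isClosed_halfIn _ _
  refine ⟨fun X => mem_GM_iff.2 ⟨hclosed X, ?_, ?_⟩, ⟨fun X u hu => ((hR X u).1 hu).1, ?_, ?_⟩,
    ⟨hmono, fun X => ?_⟩, ⟨fun hp => ?_, fun hp => ?_⟩, hconv, h0.ne_empty, ?_⟩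
  · intro x hx y hy a b ha hb hab
    rw [hR] at hx hy ⊢
    refine ⟨M.add_mem (M.smul_mem _ hx.1) (M.smul_mem _ hy.1), fun i => ?_⟩
    have hx' := mul_le_mul_of_nonneg_left (hx.2 i) ha
    have hy' := mul_le_mul_of_nonneg_left (hy.2 i) hb
    rw [inner_add_right, real_inner_smul_right, real_inner_smul_right]
    obtain rfl : b = 1 - a := by linarith
    linarith
  · rintro _ ⟨x, hx, y, hy, rfl⟩
    exact hadd X x hx y hy
  · intro X u hu
    ext v
    rw [sub_singleton, mem_image]
    have hc : ∀ i, scalarize (z i) (X + Lp.const p P u) =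
        scalarize (z i) X + inner ℝ (z i).2 u := fun i => by
      rw [hpair, map_add, ← hpair, ← hpair, scalarize_const (q := q) (hz i).1 (hz i).2.2.1]
    constructor
    · intro hv
      rw [hR] at hv
      refine ⟨v + u, (hR _ _).2 ⟨M.add_mem hv.1 hu, fun i => ?_⟩, by simp⟩
      have := hv.2 i
      rw [hc] at this
      rw [inner_add_right]
      linarith
    · rintro ⟨x, hx, rfl⟩
      rw [hR] at hx ⊢
      refine ⟨M.sub_mem hx.1 hu, fun i => ?_⟩
      rw [hc, inner_sub_right]
      linarith [hx.2 i]
  · intro X₁ X₂ hX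
    have hX' : ∀ᵐ ω ∂P, (X₂ - X₁ : Lp (Vec d) p P) ω ∈ orthant d := hX
    exact hmono X₁ X₂ (hX'.mono fun ω hω => hKT' ω hω)
  · refine Subset.antisymm (fun x hx => ⟨x, hx, 0, zero_mem_eligibleCone, add_zero x⟩) ?_
    rintro _ ⟨x, hx, y, hy, rfl⟩
    exact hadd X x hx y hy
  · refine isClosed_graph_of_mem_iff _ hR fun i => ?_
    simp_rw [hpair]
    exact (pairing (hz i).2.2.1).continuous
  · obtain rfl : q = 1 := by
      subst hp
      simpa using hpq.inv_add_inv_eq_inv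
    refine isClosed_graph_of_mem_iff _ hR fun i => ?_
    simp_rw [hpair]
    exact continuous_pairing_pairingTopology _
  · intro he
    obtain ⟨i⟩ := ‹Nonempty ι›
    -- A vector of `M` one unit below the threshold violates the `i`-th inequality at `X = 0`, so `R
    -- 0 ≠ M`.
    obtain ⟨u, hu, hc⟩ := exists_inner_eq (hw i).1 (c i - 1)
    have h := ((hR 0 u).1 (he ▸ hu)).2 i
    rw [hc, hpair, map_zero] at h
    linarith

/-- If all half-spaces are bounded by hyperplanes through the origin, then the risk measure is
coherent. -/
theorem isClosedCoherentRiskMeasure_of_mem_iff [IsProbabilityMeasure P] [p.HolderConjugate q]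
    [Fact (1 ≤ p)] [Fact (1 ≤ q)]
    (hKIM : IsClosed ((ProperCone.innerDual (KI : Set (Vec d)) : Set (Vec d))
      + (Mᗮ : Set (Vec d))))
    (hKT' : ∀ ω, orthant d ⊆ (KT ω : Set (Vec d))) [Nonempty ι]
    (hz : ∀ i, z i ∈ Wq P q M KI KT)
    (hR : ∀ X u, u ∈ R X ↔ u ∈ M ∧ ∀ i, 0 ≤ inner ℝ (z i).2 u + scalarize (z i) X) :
    IsClosedCoherentRiskMeasure M KI KT R := by
  have hpair : ∀ i X, scalarize (z i) X = pairing (p := p) (hz i).2.2.1 X := fun i X =>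
    scalarize_eq_pairing (hz i).2.2.1 X
  have h := isClosedConvexRiskMeasure_of_mem_iff (c := fun _ => 0) hKIM hKT' hz hR
    ⟨0, (hR 0 0).2 ⟨M.zero_mem, fun i => by rw [hpair]; simp⟩⟩
  refine ⟨h.mem_GM, h.riskMeasure, h.marketCompatible, h.closed, fun X t ht => ?_, fun X X' => ?_,
    h.finiteAtZero⟩
  · rintro _ ⟨x, hx, rfl⟩
    rw [hR] at hx
    refine (hR _ _).2 ⟨M.smul_mem _ hx.1, fun i => ?_⟩
    have := mul_nonneg ht.le (hx.2 i)
    rw [hpair] at this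
    rw [hpair, map_smul, real_inner_smul_right, smul_eq_mul]
    linarith
  · rintro _ ⟨x, hx, y, hy, rfl⟩
    rw [hR] at hx hy
    refine (hR _ _).2 ⟨M.add_mem hx.1 hy.1, fun i => ?_⟩
    have h1 := hx.2 i
    have h2 := hy.2 i
    rw [hpair] at h1 h2
    rw [hpair, map_add, inner_add_right]
    linarith

end HalfSpaceFamilies

/-! ### The convex representation and the minimal penalty. -/

section Representation

variable {Ω : Type*} [MeasurableSpace Ω] {P : Measure Ω} {p q : ℝ≥0∞} {d : ℕ}
  {M : Submodule ℝ (Vec d)} {KI : ProperCone ℝ (Vec d)} {KT : Ω → ProperCone ℝ (Vec d)}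
  {R : Lp (Vec d) p P → Set (Vec d)}

/-- Each value is nonempty because the common intersection is, and invariance under `G(w)` makes it
an upper set for `w` in `M`. A penalty function therefore carries one number, possibly `-∞`, per
dual variable. -/
theorem IsPenalty.eq_coe_or_eq_halfIn
    (hKIM : IsClosed ((ProperCone.innerDual (KI : Set (Vec d)) : Set (Vec d))
      + (Mᗮ : Set (Vec d)))) {negα : Wq P q M KI KT → Set (Vec d)}
    (h : IsPenalty M KI KT negα) (z : Wq P q M KI KT) :
    negα z = M ∨ ∃ c, negα z = halfIn M z.1.2 c := by
  have hw := (mem_weightSet_iff hKIM).1 z.2.2.1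
  have hM : negα z ⊆ M := by rw [h.add_halfSpace z]; exact inter_subset_right
  have hne : (negα z).Nonempty := h.inter_nonempty.mono (iInter_subset _ z)
  have := closure_eq_coe_or_eq_halfIn hw.1 hM hne fun a ha u hu hau => by
    rw [h.add_halfSpace z]
    refine ⟨subset_closure ⟨a, ha, u - a, ?_, by simp⟩, hu⟩
    change 0 ≤ inner ℝ z.1.2 (u - a)
    rw [inner_sub_right]
    linarith
  rwa [(mem_GM_iff.1 (h.mem_GM z)).1.closure_eq] at this

variable [IsProbabilityMeasure P] [hpq : p.HolderConjugate q]

theorem minPenalty_subset_halfIn {z : Wq P q M KI KT} {c : ℝ}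
    (hc : ∀ X ∈ acceptanceSet R, c ≤ scalarize z.1 X) :
    minPenalty M KI KT R z ⊆ halfIn M z.1.2 c := by
  refine closure_minimal (iUnion₂_subset fun X hX => ?_) (isClosed_halfIn _ _)
  rw [expectSet_eq_halfIn (q := q) z.2.1 z.2.2.2.1]
  exact fun u hu => ⟨hu.1, (hc X hX).trans hu.2⟩

theorem halfIn_subset_minPenalty (z : Wq P q M KI KT) {X : Lp (Vec d) p P}
    (hX : X ∈ acceptanceSet R) :
    halfIn M z.1.2 (scalarize z.1 X) ⊆ minPenalty M KI KT R z := by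
  rw [← expectSet_eq_halfIn (q := q) z.2.1 z.2.2.2.1]
  exact (subset_iUnion₂ (s := fun X (_ : X ∈ acceptanceSet R) => expectSet M z.1 X) X hX).trans
    subset_closure

theorem minPenalty_eq_coe_or_eq_halfIn
    (hKIM : IsClosed ((ProperCone.innerDual (KI : Set (Vec d)) : Set (Vec d))
      + (Mᗮ : Set (Vec d))))
    (hne : (acceptanceSet R).Nonempty) (z : Wq P q M KI KT) :
    minPenalty M KI KT R z = M ∨ ∃ c, minPenalty M KI KT R z = halfIn M z.1.2 c := by
  have hw := ((mem_weightSet_iff hKIM).1 z.2.2.1).1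
  have hexp : ∀ X : Lp (Vec d) p P, expectSet M z.1 X = halfIn M z.1.2 (scalarize z.1 X) :=
    expectSet_eq_halfIn (q := q) z.2.1 z.2.2.2.1
  refine closure_eq_coe_or_eq_halfIn hw (iUnion₂_subset fun X _ => inter_subset_right) ?_ ?_
  · obtain ⟨X, hX⟩ := hne
    refine (halfIn_nonempty hw (scalarize z.1 X)).mono ?_
    rw [← hexp]
    exact subset_iUnion₂ (s := fun X (_ : X ∈ acceptanceSet R) => expectSet M z.1 X) X hX
  · intro a ha u hu hau
    obtain ⟨X, hX, haX⟩ := mem_iUnion₂.1 ha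
    refine mem_iUnion₂.2 ⟨X, hX, ?_⟩
    rw [hexp] at haX ⊢
    exact ⟨hu, haX.2.trans hau⟩

variable [Fact (1 ≤ p)] [Fact (1 ≤ q)]

/-- An element of `L^q_d(K_T^+)` that is nonnegative on `K_I^M` and does not vanish on `M` is the
density of a dual variable. -/
theorem exists_mem_Wq
    (hKIM : IsClosed ((ProperCone.innerDual (KI : Set (Vec d)) : Set (Vec d))
      + (Mᗮ : Set (Vec d))))
    (hKT' : ∀ ω, orthant d ⊆ (KT ω : Set (Vec d))) {Y : Ω → Vec d} (hY : MemLp Y q P)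
    (hcone : ∀ᵐ ω ∂P, Y ω ∈ ProperCone.innerDual (KT ω : Set (Vec d)))
    (hpos : ∀ k ∈ eligibleCone KI M, 0 ≤ pairing (p := p) hY (Lp.const p P k))
    (hne : ∃ v ∈ M, pairing (p := p) hY (Lp.const p P v) ≠ 0) :
    ∃ z ∈ Wq P q M KI KT, ∀ X : Lp (Vec d) p P, scalarize z X = pairing hY X := by
  have hY1 : Integrable Y P := hY.integrable Fact.out
  obtain ⟨Q, hQ, hQY⟩ := exists_density_ae_eq hY1
    (hcone.mono fun ω hω => innerDual_subset_orthant (hKT' ω) hω)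
  refine ⟨(Q, ∫ ω, Y ω ∂P), ⟨hQ, (mem_weightSet_iff hKIM).2 ⟨fun h => ?_, fun x hx => ?_⟩,
    (memLp_congr_ae hQY).2 hY, ?_⟩, fun X => ?_⟩
  · obtain ⟨v, hv, hv0⟩ := hne
    rw [pairing_const] at hv0
    exact hv0 (Submodule.inner_left_of_mem_orthogonal hv h)
  · rw [← pairing_const (p := p) hY]
    exact hpos x hx
  · filter_upwards [hQY, hcone] with ω h1 h2
    rw [h1]
    exact h2
  · rw [pairing_apply]
    refine integral_congr_ae ?_
    filter_upwards [hQY] with ω hω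
    rw [hω]

namespace IsClosedConvexRiskMeasure

theorem mem_iff (h : IsClosedConvexRiskMeasure M KI KT R) {X : Lp (Vec d) p P} {u : Vec d} :
    u ∈ R X ↔ u ∈ M ∧ X + Lp.const p P u ∈ acceptanceSet R := by
  have key : u ∈ M → (X + Lp.const p P u ∈ acceptanceSet R ↔ u ∈ R X) := fun hu => by
    change (0 : Vec d) ∈ R _ ↔ _
    rw [h.riskMeasure.translative X u hu, sub_singleton, mem_image]
    constructor
    · rintro ⟨x, hx, hxu⟩
      rwa [← sub_eq_zero.1 hxu]
    · exact fun hu => ⟨u, hu, sub_self u⟩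
  exact ⟨fun hu => ⟨h.riskMeasure.subset_M X hu, (key (h.riskMeasure.subset_M X hu)).2 hu⟩,
    fun hu => (key hu.1).1 hu.2⟩

theorem add_mem_acceptanceSet (h : IsClosedConvexRiskMeasure M KI KT R) {X Z : Lp (Vec d) p P}
    (hX : X ∈ acceptanceSet R) (hZ : Z ∈ LpIn p P fun ω => (KT ω : Set (Vec d))) :
    X + Z ∈ acceptanceSet R :=
  h.marketCompatible.1 X (X + Z) (by rwa [add_sub_cancel_left]) hX

theorem add_const_mem_acceptanceSet (h : IsClosedConvexRiskMeasure M KI KT R)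
    {X : Lp (Vec d) p P} (hX : X ∈ acceptanceSet R) {k : Vec d} (hk : k ∈ eligibleCone KI M) :
    X + Lp.const p P k ∈ acceptanceSet R := by
  refine (h.mem_iff.1 ?_).2
  rw [h.marketCompatible.2 X]
  exact ⟨0, hX, k, hk, zero_add k⟩

theorem convex_acceptanceSet (h : IsClosedConvexRiskMeasure M KI KT R) :
    Convex ℝ (acceptanceSet R) := by
  refine convex_iff_forall_pos.2 fun X hX X' hX' a b ha hb hab => ?_
  obtain rfl : b = 1 - a := by linarith
  exact h.convex X X' a ha (by linarith) ⟨0, ⟨0, hX, smul_zero a⟩, 0, ⟨0, hX', smul_zero _⟩,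
    add_zero 0⟩

theorem const_mem_acceptanceSet (h : IsClosedConvexRiskMeasure M KI KT R) {u : Vec d}
    (hu : u ∈ R 0) : Lp.const p P u ∈ acceptanceSet R := by
  simpa using (h.mem_iff.1 hu).2

theorem acceptanceSet_nonempty (h : IsClosedConvexRiskMeasure M KI KT R) :
    (acceptanceSet R).Nonempty := by
  obtain ⟨u, hu⟩ := nonempty_iff_ne_empty.2 h.finiteAtZero.1
  exact ⟨_, h.const_mem_acceptanceSet hu⟩

/-- This is the content of `R 0 ≠ M`; separating such a constant yields a functional that does not
vanish on `M`. -/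
theorem exists_const_notMem_acceptanceSet (h : IsClosedConvexRiskMeasure M KI KT R) :
    ∃ u ∈ M, Lp.const p P u ∉ acceptanceSet R := by
  by_contra! hall
  refine h.finiteAtZero.2 ((h.riskMeasure.subset_M 0).antisymm fun u hu => ?_)
  exact h.mem_iff.2 ⟨hu, by simpa using hall u hu⟩

/-- A position that is not acceptable is strictly separated from the acceptance set by a dual
variable. -/
theorem exists_separation (h : IsClosedConvexRiskMeasure M KI KT R)
    (hKIM : IsClosed ((ProperCone.innerDual (KI : Set (Vec d)) : Set (Vec d))
      + (Mᗮ : Set (Vec d))))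
    (hKT : IsMeasurableSetValued fun ω => (KT ω : Set (Vec d)))
    (hKT' : ∀ ω, orthant d ⊆ (KT ω : Set (Vec d))) {X : Lp (Vec d) p P}
    (hX : X ∉ acceptanceSet R) :
    ∃ z ∈ Wq P q M KI KT, ∃ c : ℝ, scalarize z X < c ∧
      ∀ X' ∈ acceptanceSet R, c ≤ scalarize z X' := by
  have hne := h.acceptanceSet_nonempty
  have hsep : ∀ X ∉ acceptanceSet R, ∃ (Y : Ω → Vec d) (hY : MemLp Y q P) (c : ℝ),
      pairing (p := p) hY X < c ∧ ∀ X' ∈ acceptanceSet R, c ≤ pairing hY X' := fun X hX =>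
    exists_pairing_separation h.convex_acceptanceSet h.closed.isDualClosed_acceptanceSet hne
      (fun X' hX' Z hZ => h.riskMeasure.monotone X' (X' + Z) (by rwa [add_sub_cancel_left]) hX') hX
  have hfin : ∀ {Y : Ω → Vec d} (hY : MemLp Y q P) {c : ℝ},
      pairing (p := p) hY X < c → (∀ X' ∈ acceptanceSet R, c ≤ pairing hY X') →
      (∃ v ∈ M, pairing (p := p) hY (Lp.const p P v) ≠ 0) →
      ∃ z ∈ Wq P q M KI KT, ∃ c : ℝ, scalarize z X < c ∧
        ∀ X' ∈ acceptanceSet R, c ≤ scalarize z X' := fun hY c hYX hYA hv => by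
    obtain ⟨z, hz, hzY⟩ := exists_mem_Wq (p := p) (KI := KI) hKIM hKT' hY
      (ae_mem_innerDual (p := p) hKT hKT' hY fun Z hZ =>
        nonneg_of_bddBelow_of_add_mem (pairing hY).toLinearMap hne hYA fun X' hX' =>
          h.add_mem_acceptanceSet hX' hZ)
      (fun k hk => nonneg_of_bddBelow_of_add_mem (pairing hY).toLinearMap hne hYA
        fun X' hX' => h.add_const_mem_acceptanceSet hX' hk) hv
    exact ⟨z, hz, c, by rwa [hzY], fun X' hX' => by rw [hzY]; exact hYA X' hX'⟩
  obtain ⟨Y, hY, c, hYX, hYA⟩ := hsep X hX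
  by_cases hv : ∃ v ∈ M, pairing (p := p) hY (Lp.const p P v) ≠ 0
  · exact hfin hY hYX hYA hv
  -- The separator `Y` vanishes on constants from `M`, so its weight is not admissible. A functional
  -- `Y₀` separating the unacceptable constant `u₁` takes different values at `u₀` and `u₁`, and `Y
  -- + ε Y₀` is used instead.
  push Not at hv
  obtain ⟨u₀, hu₀⟩ := nonempty_iff_ne_empty.2 h.finiteAtZero.1
  have hu₀M := h.riskMeasure.subset_M 0 hu₀
  obtain ⟨u₁, hu₁, hu₁A⟩ := h.exists_const_notMem_acceptanceSet
  obtain ⟨Y₀, hY₀, c₀, hc₀, hA₀⟩ := hsep _ hu₁A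
  have hlt := hc₀.trans_le (hA₀ _ (h.const_mem_acceptanceSet hu₀))
  -- The inequality says exactly that `Y + ε Y₀` still separates `X` strictly, with threshold `c + ε
  -- * c₀`.
  obtain ⟨ε, hε, hεlt⟩ : ∃ ε : ℝ, 0 < ε ∧ ε * (pairing hY₀ X - c₀) < c - pairing hY X := by
    have hpos : 0 < c - pairing hY X := sub_pos.2 hYX
    refine ⟨(c - pairing hY X) / (|pairing hY₀ X - c₀| + 1), by positivity, ?_⟩
    rw [div_mul_eq_mul_div, div_lt_iff₀ (by positivity)]
    refine mul_lt_mul_of_pos_left ?_ hpos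
    exact (le_abs_self _).trans_lt (lt_add_one _)
  have hsum := pairing_add_const_smul (p := p) hY hY₀ ε
  refine hfin (hY.add (hY₀.const_smul ε)) (c := c + ε * c₀) ?_ (fun X' hX' => ?_)
    ⟨u₀ - u₁, M.sub_mem hu₀M hu₁, ?_⟩
  · rw [hsum]
    linarith
  · rw [hsum]
    have := mul_le_mul_of_nonneg_left (hA₀ X' hX') hε.le
    linarith [hYA X' hX']
  · rw [hsum, hv _ (M.sub_mem hu₀M hu₁), zero_add, map_sub, map_sub]
    exact mul_ne_zero hε.ne' (sub_ne_zero.2 hlt.ne')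

end IsClosedConvexRiskMeasure

/-- A map represented by a penalty function is a closed convex market-compatible risk measure. -/
theorem Represents.isClosedConvexRiskMeasure
    (hKIM : IsClosed ((ProperCone.innerDual (KI : Set (Vec d)) : Set (Vec d))
      + (Mᗮ : Set (Vec d))))
    (hKT' : ∀ ω, orthant d ⊆ (KT ω : Set (Vec d)))
    {negα : Wq P q M KI KT → Set (Vec d)} (h : IsPenalty M KI KT negα)
    (hR : Represents M KI KT negα R) : IsClosedConvexRiskMeasure M KI KT R := by
  -- Dual variables with value `M` impose only `u ∈ M`, so the inequalities are indexed by the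
  -- others.
  let ι := {z : Wq P q M KI KT // negα z ≠ M}
  have : Nonempty ι := nonempty_subtype.2 h.ne_M
  have hc : ∀ i : ι, ∃ c, negα i.1 = halfIn M i.1.1.2 c := fun i =>
    (IsPenalty.eq_coe_or_eq_halfIn hKIM h i.1).resolve_left i.2
  choose c hc using hc
  have hwM := fun z : Wq P q M KI KT => ((mem_weightSet_iff hKIM).1 z.2.2.1).1
  have hexp : ∀ (z : Wq P q M KI KT) (X : Lp (Vec d) p P),
      expectSet M z.1 (-X) = halfIn M z.1.2 (-scalarize z.1 X) := fun z X => by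
    rw [expectSet_eq_halfIn (q := q) z.2.1 z.2.2.2.1, scalarize_eq_pairing z.2.2.2.1,
      scalarize_eq_pairing z.2.2.2.1, map_neg]
  have hmem : ∀ X u, u ∈ R X ↔ u ∈ M ∧ ∀ i : ι, c i ≤ inner ℝ i.1.1.2 u + scalarize i.1.1 X :=
    fun X u => by
    have hi : ∀ i : ι, negα i.1 + expectSet M i.1.1 (-X) =
        halfIn M i.1.1.2 (c i + -scalarize i.1.1 X) := fun i => by
      rw [hexp, hc, halfIn_add_halfIn (hwM i.1)]
    rw [hR X, mem_iInter]
    constructor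
    · intro hu
      obtain ⟨i₀⟩ := this
      have hu' : ∀ i : ι, u ∈ halfIn M i.1.1.2 (c i + -scalarize i.1.1 X) := fun i => by
        rw [← hi]
        exact hu i.1
      exact ⟨(hu' i₀).1, fun i => by linarith [(hu' i).2]⟩
    · rintro ⟨huM, hu⟩ z
      by_cases hz : negα z = M
      · rw [hz, hexp, coe_add_halfIn (hwM z)]
        exact huM
      · have := hi ⟨z, hz⟩
        dsimp only at this
        rw [this]
        exact ⟨huM, by linarith [hu ⟨z, hz⟩]⟩
  refine isClosedConvexRiskMeasure_of_mem_iff hKIM hKT' (fun i : ι => i.1.2) hmem ?_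
  obtain ⟨u, hu⟩ := h.inter_nonempty
  rw [mem_iInter] at hu
  have hu' : ∀ i : ι, u ∈ halfIn M i.1.1.2 (c i) := fun i => hc i ▸ hu i.1
  obtain ⟨i₀⟩ := this
  refine ⟨u, (hmem 0 u).2 ⟨(hu' i₀).1, fun i => ?_⟩⟩
  rw [scalarize_eq_pairing i.1.2.2.2.1, map_zero, add_zero]
  exact (hu' i).2

/-- The minimal penalty is contained in every penalty function representing the same map. -/
theorem Represents.minPenalty_subset
    (hKIM : IsClosed ((ProperCone.innerDual (KI : Set (Vec d)) : Set (Vec d))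
      + (Mᗮ : Set (Vec d))))
    {negα : Wq P q M KI KT → Set (Vec d)} (h : IsPenalty M KI KT negα)
    (hR : Represents M KI KT negα R) (z : Wq P q M KI KT) :
    minPenalty M KI KT R z ⊆ negα z := by
  refine closure_minimal (iUnion₂_subset fun X hX => ?_) (mem_GM_iff.1 (h.mem_GM z)).1
  rcases IsPenalty.eq_coe_or_eq_halfIn hKIM h z with hz | ⟨c, hc⟩
  · rw [hz]
    exact inter_subset_right
  · have h0 : (0 : Vec d) ∈ negα z + expectSet M z.1 (-X) := by
      have : (0 : Vec d) ∈ R X := hX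
      rw [hR X, mem_iInter] at this
      exact this z
    rw [hc, expectSet_eq_halfIn (q := q) z.2.1 z.2.2.2.1,
      halfIn_add_halfIn ((mem_weightSet_iff hKIM).1 z.2.2.1).1, scalarize_eq_pairing z.2.2.2.1,
      map_neg] at h0
    rw [hc, expectSet_eq_halfIn (q := q) z.2.1 z.2.2.2.1, scalarize_eq_pairing z.2.2.2.1]
    have h1 := h0.2
    rw [inner_zero_right] at h1
    exact fun u hu => ⟨hu.1, by linarith [hu.2]⟩

namespace IsClosedConvexRiskMeasure

/-- A point of `R 0` lies in every value, since its constant is acceptable; separating an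
unacceptable constant bounds one value away from `M`. -/
theorem isPenalty_minPenalty (h : IsClosedConvexRiskMeasure M KI KT R)
    (hKIM : IsClosed ((ProperCone.innerDual (KI : Set (Vec d)) : Set (Vec d))
      + (Mᗮ : Set (Vec d))))
    (hKT : IsMeasurableSetValued fun ω => (KT ω : Set (Vec d)))
    (hKT' : ∀ ω, orthant d ⊆ (KT ω : Set (Vec d))) :
    IsPenalty (q := q) M KI KT (minPenalty M KI KT R) := by
  have hne := h.acceptanceSet_nonempty
  refine ⟨fun z => ?_, ?_, ?_, fun z => ?_⟩
  · rcases minPenalty_eq_coe_or_eq_halfIn hKIM hne z with hz | ⟨c, hc⟩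
    · rw [hz]
      exact coe_mem_GM
    · rw [hc]
      exact halfIn_mem_GM ((mem_weightSet_iff hKIM).1 z.2.2.1).2 c
  · obtain ⟨u, hu⟩ := nonempty_iff_ne_empty.2 h.finiteAtZero.1
    refine ⟨u, mem_iInter.2 fun z =>
      halfIn_subset_minPenalty z (h.const_mem_acceptanceSet hu)
        ⟨h.riskMeasure.subset_M 0 hu, ?_⟩⟩
    rw [scalarize_const (q := q) z.2.1 z.2.2.2.1]
  · obtain ⟨u, -, hu⟩ := h.exists_const_notMem_acceptanceSet
    obtain ⟨z, hz, c, -, hc⟩ := h.exists_separation (q := q) hKIM hKT hKT' hu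
    refine ⟨⟨z, hz⟩, fun he => ?_⟩
    refine halfIn_ne_coe ((mem_weightSet_iff hKIM).1 hz.2.1).1 c
      ((halfIn_subset _ _).antisymm ?_)
    rw [← he]
    exact minPenalty_subset_halfIn hc
  · rcases minPenalty_eq_coe_or_eq_halfIn hKIM hne z with hz | ⟨c, hc⟩
    · rw [hz, closure_coe_add_halfSpace_inter]
    · rw [hc, closure_halfIn_add_halfSpace_inter]

theorem represents_minPenalty (h : IsClosedConvexRiskMeasure M KI KT R)
    (hKIM : IsClosed ((ProperCone.innerDual (KI : Set (Vec d)) : Set (Vec d))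
      + (Mᗮ : Set (Vec d))))
    (hKT : IsMeasurableSetValued fun ω => (KT ω : Set (Vec d)))
    (hKT' : ∀ ω, orthant d ⊆ (KT ω : Set (Vec d))) :
    Represents (q := q) M KI KT (minPenalty M KI KT R) R := by
  intro X
  have hwM := fun z : Wq P q M KI KT => ((mem_weightSet_iff hKIM).1 z.2.2.1).1
  have hexp : ∀ (z : Wq P q M KI KT),
      expectSet M z.1 (-X) = halfIn M z.1.2 (-scalarize z.1 X) := fun z => by
    rw [expectSet_eq_halfIn (q := q) z.2.1 z.2.2.2.1, scalarize_eq_pairing z.2.2.2.1,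
      scalarize_eq_pairing z.2.2.2.1, map_neg]
  have hXu : ∀ (z : Wq P q M KI KT) u, scalarize z.1 (X + Lp.const p P u) =
      scalarize z.1 X + inner ℝ z.1.2 u := fun z u => by
    rw [← scalarize_const (p := p) (q := q) z.2.1 z.2.2.2.1, scalarize_eq_pairing z.2.2.2.1,
      scalarize_eq_pairing z.2.2.2.1, scalarize_eq_pairing z.2.2.2.1, map_add]
  refine Subset.antisymm (fun u hu => mem_iInter.2 fun z => ?_) fun u hu => ?_
  · have hA := h.mem_iff.1 hu
    have hsub := add_subset_add_right (t := expectSet M z.1 (-X))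
      (halfIn_subset_minPenalty z hA.2)
    refine hsub ?_
    rw [hexp, halfIn_add_halfIn (hwM z), hXu]
    exact ⟨hA.1, by linarith⟩
  · rw [mem_iInter] at hu
    have hsep : ∀ X' ∉ acceptanceSet R, ∃ (z : Wq P q M KI KT) (c : ℝ), scalarize z.1 X' < c ∧
        u ∈ halfIn M z.1.2 (c + -scalarize z.1 X) := fun X' hX' => by
      obtain ⟨z, hz, c, hlt, hc⟩ := h.exists_separation (q := q) hKIM hKT hKT' hX'
      refine ⟨⟨z, hz⟩, c, hlt, ?_⟩
      rw [← halfIn_add_halfIn (hwM ⟨z, hz⟩), ← hexp]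
      exact add_subset_add_right (minPenalty_subset_halfIn hc) (hu ⟨z, hz⟩)
    -- An unacceptable constant provides a dual variable, so the intersection is not taken over an
    -- empty family and lies in `M`.
    have huM : u ∈ M := by
      obtain ⟨u₁, -, hu₁⟩ := h.exists_const_notMem_acceptanceSet
      obtain ⟨z, c, -, hz⟩ := hsep _ hu₁
      exact hz.1
    refine h.mem_iff.2 ⟨huM, ?_⟩
    by_contra hA
    obtain ⟨z, c, hlt, hz⟩ := hsep _ hA
    rw [hXu] at hlt
    linarith [hz.2]

end IsClosedConvexRiskMeasure

/-! ### The coherent representation. -/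

theorem mem_iff_of_coherentlyRepresents {W : Set ((Fin d → Measure Ω) × Vec d)}
    (hW : W ⊆ Wq P q M KI KT) (hne : W.Nonempty) (hR : CoherentlyRepresents M W R)
    (X : Lp (Vec d) p P) (u : Vec d) :
    u ∈ R X ↔ u ∈ M ∧ ∀ z : W, 0 ≤ inner ℝ z.1.2 u + scalarize z.1 X := by
  have hexp : ∀ z ∈ W, expectSet M z (-X) = halfIn M z.2 (-scalarize z X) := fun z hz => by
    have hz' := hW hz
    rw [expectSet_eq_halfIn (q := q) hz'.1 hz'.2.2.1, scalarize_eq_pairing hz'.2.2.1,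
      scalarize_eq_pairing hz'.2.2.1, map_neg]
  rw [hR X, mem_iInter₂]
  constructor
  · intro hu
    obtain ⟨z₀, hz₀⟩ := hne
    refine ⟨(hu z₀ hz₀).2, fun z => ?_⟩
    have := hu z.1 z.2
    rw [hexp z.1 z.2] at this
    linarith [this.2]
  · rintro ⟨huM, hu⟩ z hz
    rw [hexp z hz]
    exact ⟨huM, by linarith [hu ⟨z, hz⟩]⟩

theorem CoherentlyRepresents.subset_WqMax {W : Set ((Fin d → Measure Ω) × Vec d)}
    (hW : W ⊆ Wq P q M KI KT) (hR : CoherentlyRepresents M W R) : W ⊆ WqMax q M KI R :=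
  fun z hz => by
  refine ⟨(hW hz).1, (hW hz).2.1, (hW hz).2.2.1, fun X hX => ?_⟩
  have := ((mem_iff_of_coherentlyRepresents hW ⟨z, hz⟩ hR X 0).1 hX).2 ⟨z, hz⟩
  rwa [inner_zero_right, zero_add] at this

namespace IsClosedCoherentRiskMeasure

theorem isClosedConvexRiskMeasure (h : IsClosedCoherentRiskMeasure M KI KT R) :
    IsClosedConvexRiskMeasure M KI KT R := by
  refine ⟨h.mem_GM, h.riskMeasure, h.marketCompatible, h.closed, fun X X' t ht0 ht1 => ?_,
    h.finiteAtZero⟩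
  exact (add_subset_add (h.posHomogeneous X t ht0)
    (h.posHomogeneous X' (1 - t) (sub_pos.2 ht1))).trans (h.subadditive _ _)

theorem add_mem_acceptanceSet (h : IsClosedCoherentRiskMeasure M KI KT R) {X X' : Lp (Vec d) p P}
    (hX : X ∈ acceptanceSet R) (hX' : X' ∈ acceptanceSet R) : X + X' ∈ acceptanceSet R :=
  h.subadditive X X' ⟨0, hX, 0, hX', add_zero 0⟩

/-- Positive homogeneity concerns only `t > 0`, so `0 ∈ R 0` is reached as the limit of `t • u` with
`u ∈ R 0`, using that `R 0` is closed. -/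
theorem zero_mem_acceptanceSet (h : IsClosedCoherentRiskMeasure M KI KT R) :
    (0 : Lp (Vec d) p P) ∈ acceptanceSet R := by
  obtain ⟨u, hu⟩ := nonempty_iff_ne_empty.2 h.finiteAtZero.1
  have htend : Filter.Tendsto (fun t : ℝ => t • u) (nhdsWithin 0 (Ioi 0)) (nhds 0) := by
    have : Continuous fun t : ℝ => t • u := by fun_prop
    simpa using (this.tendsto 0).mono_left nhdsWithin_le_nhds
  refine (mem_GM_iff.1 (h.mem_GM 0)).1.mem_of_tendsto htend ?_
  filter_upwards [self_mem_nhdsWithin] with t ht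
  have := h.posHomogeneous 0 t ht ⟨u, hu, rfl⟩
  rwa [smul_zero] at this

/-- Since `0` is acceptable, monotonicity puts `L^p_d(K_T)` inside the acceptance set, so its dual
cone lies in `L^q_d(K_T^+)`. -/
theorem WqMax_subset (h : IsClosedCoherentRiskMeasure M KI KT R)
    (hKT : IsMeasurableSetValued fun ω => (KT ω : Set (Vec d)))
    (hKT' : ∀ ω, orthant d ⊆ (KT ω : Set (Vec d))) :
    WqMax q M KI R ⊆ Wq P q M KI KT := fun z hz => by
  refine ⟨hz.1, hz.2.1, hz.2.2.1, ae_mem_innerDual (p := p) hKT hKT' hz.2.2.1 fun Z hZ => ?_⟩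
  rw [pairing_apply]
  refine hz.2.2.2 Z ?_
  simpa using h.isClosedConvexRiskMeasure.add_mem_acceptanceSet h.zero_mem_acceptanceSet hZ

/-- Every acceptable position is a direction of recession of the acceptance set, so the separating
functional is nonnegative there; evaluating at `0` gives `c ≤ 0`. -/
theorem exists_mem_WqMax (h : IsClosedCoherentRiskMeasure M KI KT R)
    (hKIM : IsClosed ((ProperCone.innerDual (KI : Set (Vec d)) : Set (Vec d))
      + (Mᗮ : Set (Vec d))))
    (hKT : IsMeasurableSetValued fun ω => (KT ω : Set (Vec d)))
    (hKT' : ∀ ω, orthant d ⊆ (KT ω : Set (Vec d))) {X : Lp (Vec d) p P}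
    (hX : X ∉ acceptanceSet R) : ∃ z ∈ WqMax q M KI R, scalarize z X < 0 := by
  obtain ⟨z, hz, c, hlt, hc⟩ :=
    h.isClosedConvexRiskMeasure.exists_separation (q := q) hKIM hKT hKT' hX
  simp only [scalarize_eq_pairing hz.2.2.1] at hlt hc
  refine ⟨z, ⟨hz.1, hz.2.1, hz.2.2.1, fun X' hX' => ?_⟩, ?_⟩
  · rw [← pairing_apply (p := p) hz.2.2.1]
    exact nonneg_of_bddBelow_of_add_mem (pairing hz.2.2.1).toLinearMap
      ⟨0, h.zero_mem_acceptanceSet⟩ hc fun X hX => h.add_mem_acceptanceSet hX hX'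
  · rw [scalarize_eq_pairing hz.2.2.1]
    have := hc 0 h.zero_mem_acceptanceSet
    rw [map_zero] at this
    exact hlt.trans_le this

theorem WqMax_nonempty (h : IsClosedCoherentRiskMeasure M KI KT R)
    (hKIM : IsClosed ((ProperCone.innerDual (KI : Set (Vec d)) : Set (Vec d))
      + (Mᗮ : Set (Vec d))))
    (hKT : IsMeasurableSetValued fun ω => (KT ω : Set (Vec d)))
    (hKT' : ∀ ω, orthant d ⊆ (KT ω : Set (Vec d))) : (WqMax q M KI R).Nonempty := by
  obtain ⟨u, -, hu⟩ := h.isClosedConvexRiskMeasure.exists_const_notMem_acceptanceSet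
  obtain ⟨z, hz, -⟩ := h.exists_mem_WqMax (q := q) hKIM hKT hKT' hu
  exact ⟨z, hz⟩

theorem coherentlyRepresents_WqMax (h : IsClosedCoherentRiskMeasure M KI KT R)
    (hKIM : IsClosed ((ProperCone.innerDual (KI : Set (Vec d)) : Set (Vec d))
      + (Mᗮ : Set (Vec d))))
    (hKT : IsMeasurableSetValued fun ω => (KT ω : Set (Vec d)))
    (hKT' : ∀ ω, orthant d ⊆ (KT ω : Set (Vec d))) :
    CoherentlyRepresents M (WqMax q M KI R) R := by
  intro X
  have hsub := h.WqMax_subset (q := q) hKT hKT'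
  have hexp : ∀ z ∈ WqMax q M KI R, ∀ u, u ∈ expectSet M z (-X) ↔
      u ∈ M ∧ 0 ≤ scalarize z (X + Lp.const p P u) := fun z hz u => by
    have hz' := hsub hz
    rw [expectSet_eq_halfIn (q := q) hz'.1 hz'.2.2.1, scalarize_eq_pairing hz'.2.2.1,
      scalarize_eq_pairing hz'.2.2.1, map_neg, map_add, ← scalarize_eq_pairing hz'.2.2.1
        (Lp.const p P u), scalarize_const (q := q) hz'.1 hz'.2.2.1, ← neg_le_iff_add_nonneg']
    rfl
  ext u
  rw [mem_iInter₂, h.isClosedConvexRiskMeasure.mem_iff]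
  constructor
  · rintro ⟨huM, hu⟩ z hz
    exact (hexp z hz u).2 ⟨huM, hz.2.2.2 _ hu⟩
  · intro hu
    obtain ⟨z₀, hz₀⟩ := h.WqMax_nonempty (q := q) hKIM hKT hKT'
    refine ⟨(hu z₀ hz₀).2, ?_⟩
    by_contra hA
    obtain ⟨z, hz, hlt⟩ := h.exists_mem_WqMax (q := q) hKIM hKT hKT' hA
    exact absurd ((hexp z hz u).1 (hu z hz)).2 (not_le.2 hlt)

end IsClosedCoherentRiskMeasure

end Representation

end SetRisk

theorem mainTheorem1 {Ω : Type*} [MeasurableSpace Ω] (P : Measure Ω) [IsProbabilityMeasure P]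
    (d : ℕ) (p q : ℝ≥0∞) [Fact (1 ≤ p)] (hpq : p.HolderConjugate q)
    -- the space of eligible portfolios
    (M : Submodule ℝ (SetRisk.Vec d))
    (hM : ∃ u ∈ M, u ∈ SetRisk.orthant d ∧ u ≠ 0)
    -- the solvency cone at the initial time
    (KI : ProperCone ℝ (SetRisk.Vec d))
    (hKI : SetRisk.orthant d ⊆ (KI : Set (SetRisk.Vec d)))
    (hKI' : (KI : Set (SetRisk.Vec d)) ≠ Set.univ)
    (hKIM : IsClosed ((ProperCone.innerDual (KI : Set (SetRisk.Vec d)) : Set (SetRisk.Vec d))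
      + (Mᗮ : Set (SetRisk.Vec d))))
    -- the solvency cones at the terminal time
    (KT : Ω → ProperCone ℝ (SetRisk.Vec d))
    (hKT : SetRisk.IsMeasurableSetValued fun ω => (KT ω : Set (SetRisk.Vec d)))
    (hKT' : ∀ ω, SetRisk.orthant d ⊆ (KT ω : Set (SetRisk.Vec d)))
    (hKT'' : ∀ ω, (KT ω : Set (SetRisk.Vec d)) ≠ Set.univ)
    (R : Lp (SetRisk.Vec d) p P → Set (SetRisk.Vec d)) :
    -- convex case
    (SetRisk.IsClosedConvexRiskMeasure M KI KT R ↔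
      ∃ negα : SetRisk.Wq P q M KI KT → Set (SetRisk.Vec d),
        SetRisk.IsPenalty M KI KT negα ∧ SetRisk.Represents M KI KT negα R) ∧
    (SetRisk.IsClosedConvexRiskMeasure M KI KT R →
      SetRisk.IsPenalty (q := q) M KI KT (SetRisk.minPenalty M KI KT R) ∧
      SetRisk.Represents (q := q) M KI KT (SetRisk.minPenalty M KI KT R) R) ∧
    (∀ negα : SetRisk.Wq P q M KI KT → Set (SetRisk.Vec d),
      SetRisk.IsPenalty M KI KT negα → SetRisk.Represents M KI KT negα R →
        ∀ z, SetRisk.minPenalty M KI KT R z ⊆ negα z) ∧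
    -- coherent case
    (SetRisk.IsClosedCoherentRiskMeasure M KI KT R ↔
      ∃ W ⊆ SetRisk.Wq P q M KI KT, W.Nonempty ∧ SetRisk.CoherentlyRepresents M W R) ∧
    (SetRisk.IsClosedCoherentRiskMeasure M KI KT R →
      SetRisk.WqMax q M KI R ⊆ SetRisk.Wq P q M KI KT ∧
      (SetRisk.WqMax q M KI R).Nonempty ∧
      SetRisk.CoherentlyRepresents M (SetRisk.WqMax q M KI R) R) ∧
    (∀ W ⊆ SetRisk.Wq P q M KI KT, SetRisk.CoherentlyRepresents M W R →
      W ⊆ SetRisk.WqMax q M KI R) := by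

  have : Fact (1 ≤ q) := ⟨hpq.symm.one_le⟩
  refine ⟨⟨fun h => ⟨_, h.isPenalty_minPenalty hKIM hKT hKT',
      h.represents_minPenalty hKIM hKT hKT'⟩,
      fun ⟨_, hα, hR⟩ => hR.isClosedConvexRiskMeasure hKIM hKT' hα⟩,
    fun h => ⟨h.isPenalty_minPenalty hKIM hKT hKT', h.represents_minPenalty hKIM hKT hKT'⟩,
    fun _ hα hR z => hR.minPenalty_subset hKIM hα z,
    ⟨fun h => ⟨_, h.WqMax_subset hKT hKT', h.WqMax_nonempty hKIM hKT hKT',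
      h.coherentlyRepresents_WqMax hKIM hKT hKT'⟩, ?_⟩,
    fun h => ⟨h.WqMax_subset hKT hKT', h.WqMax_nonempty hKIM hKT hKT',
      h.coherentlyRepresents_WqMax hKIM hKT hKT'⟩,
    fun _ hW hR => hR.subset_WqMax hW⟩
  rintro ⟨W, hW, hne, hR⟩
  have := hne.to_subtype
  exact SetRisk.isClosedCoherentRiskMeasure_of_mem_iff hKIM hKT' (fun z : W => hW z.2)
    (SetRisk.mem_iff_of_coherentlyRepresents hW hne hR)
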